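/- Let $0<p<1$. In the Bernoulli growth model one starts (size $1$) with a single directed edge from a source to a sink; given a network of size $n-1\ge 1$ (that is, with $n-1$ edges), one of its edges $(x,y)$ is chosen uniformly at random and, independently, with probability $p$ it is doubled in parallel (a further edge $(x,y)$ is added), and with probability $1-p$ it is doubled serially ($(x,y)$ is replaced by $(x,z)$ and $(z,y)$ with a new node $z$), which gives the network of size $n$. Let $D_n$ be the degree of the source in the random network of size $n$. The degree of the sink has the same distribution as $D_n$. As $n\to\infty$, $D_n/n^p$ (and likewise the degree of the sink divided by $n^p$) converges in distribution to a random variable $D$ that is Mittag-Leffler distributed with parameter $p$, i.e. $\mathbb{E}(e^{tD})=\sum_{r\ge0} t^r/\Gamma(rp+1)$ for all real $t$. All moments of $D$ exist, with $$\mathbb{E}(D^r)=\frac{r!}{\Gamma(rp+1)}\qquad(r\ge 0),$$ and the law of $D$ is the only probability distribution on $\mathbb{R}$ with these moments. Moreover, the law of $D$ is concentrated on $(0,\infty)$, where it has the density $$f(x)=\frac{1}{2\pi i}\int_{\mathcal H}\frac{e^{-t-x(-t)^p}}{(-t)^{1-p}}\,dt,\qquad x>0,$$ where the powers of $-t$ are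 principal values, the integral converges absolutely, and $\mathcal H$ is a Hankel contour: for an arbitrary $\delta>0$, it comes from $+\infty-i\delta$ along a horizontal ray to $-i\delta$, runs clockwise along the half circle $|t|=\delta$, $\operatorname{Re} t\le 0$, to $i\delta$, and goes along a horizontal ray to $+\infty+i\delta$. -/

import Mathlib

open MeasureTheory ProbabilityTheory Filter Set

noncomputable section

namespace BernoulliGrowth

/-- A two-terminal multi-digraph with `n` labelled directed edges: `G j = (x, y)` means that the
`j`-th edge is directed from the node `x` to the node `y`. Nodes are named by natural numbers.
(The left-to-right order of parallel edges is not recorded.) -/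
abbrev Network (n : ℕ) : Type := Fin n → ℕ × ℕ

/-- The north pole. -/
def source : ℕ := 0

/-- The south pole. -/
def sink : ℕ := 1

/-- The network of size one: a single edge from the source to the sink. -/
def initial : Network 1 := fun _ => (source, sink)

/-- Parallel doubling of the edge `j = (x, y)`: a further edge `(x, y)` is added, with the
next label. -/
def parallelDoubling {n : ℕ} (G : Network n) (j : Fin n) : Network (n + 1) :=
  Fin.snoc (α := fun _ => ℕ × ℕ) G (G j)

/-- Serial doubling of the edge `j = (x, y)`: it is replaced by `(x, z)`, which keeps the label `j`,
and `(z, y)`, which gets the next label. The new node `z` is named `n + 1`; for `n ≥ 1` this name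
differs from those of the poles and of the nodes created in earlier steps. -/
def serialDoubling {n : ℕ} (G : Network n) (j : Fin n) : Network (n + 1) :=
  Fin.snoc (α := fun _ => ℕ × ℕ) (Function.update G j ((G j).1, n + 1)) (n + 1, (G j).2)

/-- The degree of the node `v`: the number of outgoing edges plus the number of incoming edges. -/
def degree {n : ℕ} (G : Network n) (v : ℕ) : ℕ :=
  (Finset.univ.filter fun j => (G j).1 = v).card + (Finset.univ.filter fun j => (G j).2 = v).card

/-- A coin showing `true` with probability `p` and `false` with probability `1 - p`. -/
def coin (p : ℝ) (hp : p ∈ Icc (0 : ℝ) 1) : PMF Bool :=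
  PMF.ofFintype (fun b => ENNReal.ofReal (if b then p else 1 - p)) (by
    simp [← ENNReal.ofReal_add hp.1 (sub_nonneg.2 hp.2)])

/-- The law of the random network of size `n + 1` in the Bernoulli model: start with a single edge;
in each step an edge of the current network is chosen uniformly at random, and independently it is
doubled in a parallel way with probability `p`, in a serial way with probability `1 - p`. -/
def networkLaw (p : ℝ) (hp : p ∈ Icc (0 : ℝ) 1) : (n : ℕ) → PMF (Network (n + 1))
  | 0 => PMF.pure initial
  | n + 1 =>
    (networkLaw p hp n).bind fun G =>
      (PMF.uniformOfFintype (Fin (n + 1))).bind fun j =>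
        (coin p hp).map fun b => if b then parallelDoubling G j else serialDoubling G j

/-- The Mittag-Leffler distribution with parameter `p`: its moment generating function is
everywhere finite and equals the Mittag-Leffler function `E_p(t) = ∑ t ^ r / Γ(r p + 1)`. -/
def IsMittagLeffler (p : ℝ) (ν : Measure ℝ) : Prop :=
  ∀ t : ℝ, Integrable (fun x => Real.exp (t * x)) ν ∧
    HasSum (fun r : ℕ => t ^ r / Real.Gamma (r * p + 1)) (∫ x, Real.exp (t * x) ∂ν)

/-- The Hankel contour of radius `δ > 0` consists of the ray `{w - δ i : w ≥ 0}` traversed from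
`+∞ - δ i` to `-δ i`, the left half circle `{δ e ^ (i φ)}` traversed clockwise from `φ = 3 π / 2`
to `φ = π / 2`, and the ray `{w + δ i : w ≥ 0}` traversed from `δ i` to `+∞ + δ i`.
This says that `F` is absolutely integrable along it. -/
def HankelIntegrable (δ : ℝ) (F : ℂ → ℂ) : Prop :=
  IntegrableOn (fun w : ℝ => F (w - δ * Complex.I)) (Ioi 0) ∧
  IntervalIntegrable (fun φ : ℝ => F (circleMap 0 δ φ) * deriv (circleMap 0 δ) φ) volume
    (3 * Real.pi / 2) (Real.pi / 2) ∧
  IntegrableOn (fun w : ℝ => F (w + δ * Complex.I)) (Ioi 0)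

/-- The integral of `F` along the Hankel contour of radius `δ`. -/
def hankelIntegral (δ : ℝ) (F : ℂ → ℂ) : ℂ :=
  -(∫ w : ℝ in Ioi 0, F (w - δ * Complex.I)) +
  (∫ φ : ℝ in (3 * Real.pi / 2)..(Real.pi / 2),
    F (circleMap 0 δ φ) * deriv (circleMap 0 δ) φ) +
  ∫ w : ℝ in Ioi 0, F (w + δ * Complex.I)

/-- The integrand `e ^ (-t - x (-t) ^ p) / (-t) ^ (1 - p)`, with principal powers of `-t`, so that
the cut is the positive real axis in `t`, around which the Hankel contour runs. -/
def densityIntegrand (p x : ℝ) (t : ℂ) : ℂ :=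
  Complex.exp (-t - x * (-t) ^ (p : ℂ)) / (-t) ^ ((1 : ℂ) - p)

end BernoulliGrowth

end

/-! The degree of a pole is itself a Markov chain: from degree `d` in a network with `m` edges it
rises by one with probability `p * d / m`, since only a parallel doubling of an edge at the pole
changes it (`map_degree_networkLaw`). The rising factorials `d (d + 1) ⋯ (d + r - 1)` are
eigenfunctions of each step, with factor `(m + r p) / m`. Their expectations are therefore explicit
products, and Euler's limit for the Gamma function gives their growth `r! n ^ (r p) / Γ(r p + 1)`
(`tendsto_risingMoment`). Ordinary powers differ from rising factorials by terms of lower order, so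
all moments of the normalized degree converge (`tendsto_integral_pow_degreeLaw`).

A measure with the limiting moments is produced directly from the contour integral. With `s = -t`
the candidate density is `(2 π i)⁻¹ ∫ e ^ s s ^ (p - 1) e ^ (-x s ^ p) ds`. If the contour is opened
only slightly beyond the imaginary directions, then `Re s ^ p > 0` on it, so Fubini applies.
Integrating `x ^ r` first leaves `r! (2 π i)⁻¹ ∫ e ^ s s ^ (-r p - 1) ds`, which is `r! / Γ(r p +
1)` by Hankel's formula (`contourIntegral_eq_div_Gamma`, `integral_pow_mul_limitDensity`). In the
coordinate `u = log s` the integrand is entire, so every deformation of the contour is a comparison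
of the values of one primitive at the two ends (`exists_primitive_with_limits`).

It remains to see that the candidate is nonnegative (`limitDensity_nonneg`). Its positive part has
the limiting moments plus those of its negative part. Adding the negative part to the laws of the
normalized degrees and normalizing, the method of moments gives convergence to the normalized
positive part. On a closed ball where the candidate is negative, the approximating measures keep a
fixed positive mass while the limit has none, which contradicts the portmanteau theorem.

The candidate decays faster than every exponential (`exists_limitDensity_bound`). Hence the Taylor
series of the characteristic function converges, which yields the method of moments, uniqueness, and
the moment generating function. -/

namespace BernoulliGrowth

open scoped ENNReal

/-! ### The Markov chain of the degree of a pole -/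

/-- One step of the degree chain: in a network with `m` edges, `d` of which meet the pole, a uniformly
chosen edge meets the pole and is doubled in parallel with probability `p * d / m`. -/
noncomputable def degreeStep (p : ℝ) (hp : p ∈ Icc (0 : ℝ) 1) (n d : ℕ) : PMF ℕ :=
  (PMF.uniformOfFintype (Fin (n + 1))).bind fun j =>
    (coin p hp).map fun b => if b && decide (j.val < d) then d + 1 else d

/-- The law of the degree of a pole in the random network of size `n + 1`. -/
noncomputable def degreeLaw (p : ℝ) (hp : p ∈ Icc (0 : ℝ) 1) : ℕ → PMF ℕ
  | 0 => PMF.pure 1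
  | n + 1 => (degreeLaw p hp n).bind (degreeStep p hp n)

theorem bind_congr_of_mem_support {α β : Type*} (μ : PMF α) {f g : α → PMF β}
    (h : ∀ a ∈ μ.support, f a = g a) : μ.bind f = μ.bind g := by
  ext b
  simp only [PMF.bind_apply]
  refine tsum_congr fun a => ?_
  by_cases ha : a ∈ μ.support
  · rw [h a ha]
  · rw [PMF.mem_support_iff, not_not] at ha
    simp [ha]

/-- A uniform choice is invariant under permutations. -/
theorem uniform_bind_comp_perm {α β : Type*} [Fintype α] [Nonempty α] (e : Equiv.Perm α)
    (f : α → PMF β) :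
    (PMF.uniformOfFintype α).bind (fun a => f (e a)) = (PMF.uniformOfFintype α).bind f := by
  ext b
  simp only [PMF.bind_apply, PMF.uniformOfFintype_apply]
  exact e.tsum_eq fun a => (Fintype.card α : ℝ≥0∞)⁻¹ * f a b

/-- Only the number of indices satisfying `P` matters: some permutation carries them onto an initial
segment of the same size. This replaces the actual set of edges at a pole by the labels below `d`
used in `degreeStep`. -/
theorem uniform_bind_predicate {β : Type*} {n : ℕ} (P : Fin (n + 1) → Prop) [DecidablePred P]
    (f : Bool → PMF β) :
    (PMF.uniformOfFintype (Fin (n + 1))).bind (fun j => f (decide (P j))) =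
      (PMF.uniformOfFintype (Fin (n + 1))).bind
        (fun j => f (decide (j.val < (Finset.univ.filter P).card))) := by
  have hle : (Finset.univ.filter P).card ≤ n + 1 := by
    simpa using Finset.card_le_univ (Finset.univ.filter P)
  have hc : Fintype.card {j // P j} =
      Fintype.card {j : Fin (n + 1) // j.val < (Finset.univ.filter P).card} := by
    rw [Fintype.card_subtype, Fintype.card_subtype, Fin.card_filter_val_lt, min_eq_right hle]
  let e := Fintype.equivOfCardEq hc
  rw [← uniform_bind_comp_perm e.extendSubtype
    fun j : Fin (n + 1) => f (decide (j.val < (Finset.univ.filter P).card))]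
  congr 1
  funext j
  congr 1
  refine decide_eq_decide.2 ⟨fun h => e.extendSubtype_mem j h, fun h => ?_⟩
  by_contra hj
  exact e.extendSubtype_not_mem j hj h

/-- The edges that leave the source, or enter the sink. -/
def Meets (v : ℕ) (e : ℕ × ℕ) : Prop := if v = source then e.1 = source else e.2 = sink

instance (v : ℕ) : DecidablePred (Meets v) := fun e => by unfold Meets; infer_instance

/-- No edge enters the source and no edge leaves the sink. -/
def IsPolar {n : ℕ} (G : Network n) : Prop := ∀ j, (G j).2 ≠ source ∧ (G j).1 ≠ sink

theorem IsPolar.degree_eq {n : ℕ} {G : Network n} (hG : IsPolar G) {v : ℕ}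
    (hv : v ∈ ({source, sink} : Set ℕ)) :
    degree G v = (Finset.univ.filter fun j => Meets v (G j)).card := by
  rcases hv with rfl | rfl
  · simp [degree, Meets, (hG _).1]
  · have h : sink ≠ source := by decide
    simp [degree, Meets, (hG _).2, h]

theorem IsPolar.parallelDoubling {n : ℕ} {G : Network n} (hG : IsPolar G) (j : Fin n) :
    IsPolar (parallelDoubling G j) := by
  intro i
  refine Fin.lastCases ?_ (fun i => ?_) i
  · simpa [BernoulliGrowth.parallelDoubling] using hG j
  · simpa [BernoulliGrowth.parallelDoubling] using hG i

theorem IsPolar.serialDoubling {n : ℕ} {G : Network (n + 1)} (hG : IsPolar G) (j : Fin (n + 1)) :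
    IsPolar (serialDoubling G j) := by
  intro i
  refine Fin.lastCases ?_ (fun i => ?_) i
  · simpa [BernoulliGrowth.serialDoubling, sink] using (hG j).1
  · by_cases h : i = j
    · subst h
      simpa [BernoulliGrowth.serialDoubling, source] using (hG i).2
    · simpa [BernoulliGrowth.serialDoubling, Function.update_of_ne h] using hG i

theorem isPolar_of_mem_support {p : ℝ} (hp : p ∈ Icc (0 : ℝ) 1) (n : ℕ) :
    ∀ G ∈ (networkLaw p hp n).support, IsPolar G := by
  induction n with
  | zero =>
    intro G hG
    rw [networkLaw, PMF.support_pure, mem_singleton_iff] at hG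
    subst hG
    intro j
    simp [initial, source, sink]
  | succ n ih =>
    intro G hG
    simp only [networkLaw, PMF.mem_support_bind_iff, PMF.mem_support_map_iff] at hG
    obtain ⟨G', hG', j, -, b, -, rfl⟩ := hG
    cases b
    · simpa using (ih G' hG').serialDoubling j
    · simpa using (ih G' hG').parallelDoubling j

theorem card_filter_snoc {α : Type*} {n : ℕ} (P : α → Prop) [DecidablePred P] (G : Fin n → α)
    (a : α) :
    (Finset.univ.filter fun j => P (Fin.snoc (α := fun _ => α) G a j)).card =
      (Finset.univ.filter fun j => P (G j)).card + if P a then 1 else 0 := by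
  simp only [Finset.card_filter, Fin.sum_univ_castSucc, Fin.snoc_castSucc, Fin.snoc_last]

theorem card_meets_parallelDoubling {n : ℕ} (G : Network n) (j : Fin n) (v : ℕ) :
    (Finset.univ.filter fun i => Meets v (parallelDoubling G j i)).card =
      (Finset.univ.filter fun i => Meets v (G i)).card + if Meets v (G j) then 1 else 0 :=
  card_filter_snoc (Meets v) G (G j)

/-- At the source, edge `j` keeps its tail and the new edge starts at the new node. At the sink,
edge `j` loses its head and the new edge inherits it. The new node is not a pole, so nothing else is
counted. -/
theorem card_meets_serialDoubling {n : ℕ} (G : Network (n + 1)) (j : Fin (n + 1)) (v : ℕ) :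
    (Finset.univ.filter fun i => Meets v (serialDoubling G j i)).card =
      (Finset.univ.filter fun i => Meets v (G i)).card := by
  have h := card_filter_snoc (Meets v) (Function.update G j ((G j).1, n + 1 + 1))
    (n + 1 + 1, (G j).2)
  rw [serialDoubling, h]
  by_cases hv : v = source
  · have : ∀ i, Meets v (Function.update G j ((G j).1, n + 1 + 1) i) ↔ Meets v (G i) := by
      intro i
      by_cases hi : i = j
      · subst hi; simp [Meets, hv]
      · rw [Function.update_of_ne hi]
    simp only [this]
    simp [Meets, hv, source]
  · simp only [Finset.card_filter]
    -- The incidence with the sink moves from label `j` to the last label, so the sums are compared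
    -- after splitting off `j`.
    rw [← Finset.add_sum_erase _ _ (Finset.mem_univ j),
      ← Finset.add_sum_erase _ (fun i => if Meets v (G i) then 1 else 0) (Finset.mem_univ j)]
    have : ∀ i ∈ Finset.univ.erase j,
        (if Meets v (Function.update G j ((G j).1, n + 1 + 1) i) then 1 else 0) =
          if Meets v (G i) then 1 else 0 := by
      intro i hi
      rw [Function.update_of_ne (Finset.ne_of_mem_erase hi)]
    rw [Finset.sum_congr rfl this]
    simp [Meets, hv, sink]
    omega

theorem map_degree_networkLaw {p : ℝ} (hp : p ∈ Icc (0 : ℝ) 1) (n : ℕ) {v : ℕ}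
    (hv : v ∈ ({source, sink} : Set ℕ)) :
    (networkLaw p hp n).map (fun G => degree G v) = degreeLaw p hp n := by
  induction n with
  | zero =>
    rw [networkLaw, PMF.pure_map, degreeLaw]
    rcases hv with rfl | rfl <;> simp [degree, initial, source, sink]
  | succ n ih =>
    rw [networkLaw, degreeLaw, ← ih, PMF.map_bind, PMF.bind_map]
    -- The two step laws agree only for polar networks, so the comparison is confined to the
    -- support.
    refine bind_congr_of_mem_support _ fun G hG => ?_
    have hG := isPolar_of_mem_support hp n G hG
    rw [Function.comp_apply, degreeStep, hG.degree_eq hv]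
    have h := uniform_bind_predicate (fun j => Meets v (G j)) fun c =>
      (coin p hp).map fun b => if b && c then (Finset.univ.filter fun j => Meets v (G j)).card + 1
        else (Finset.univ.filter fun j => Meets v (G j)).card
    rw [PMF.map_bind]
    convert h using 2
    · funext j
      rw [PMF.map_comp]
      congr 1
      funext b
      cases b
      · simp [(hG.serialDoubling j).degree_eq hv, card_meets_serialDoubling]
      · by_cases hj : Meets v (G j)
        · simp [(hG.parallelDoubling j).degree_eq hv, card_meets_parallelDoubling, hj]
        · simp [(hG.parallelDoubling j).degree_eq hv, card_meets_parallelDoubling, hj]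

end BernoulliGrowth

namespace BernoulliGrowth

open scoped ENNReal Topology

/-! ### Rising factorial moments of the degree -/

/-- The `r`-th rising factorial moment of the degree of a pole in a network of size `n + 1`. -/
noncomputable def risingMoment (p : ℝ) (r n : ℕ) : ℝ :=
  r.factorial * ∏ k ∈ Finset.range n, ((k + 1 + r * p) / (k + 1))

theorem risingMoment_nonneg {p : ℝ} (hp : 0 ≤ p) (r n : ℕ) : 0 ≤ risingMoment p r n := by
  unfold risingMoment
  positivity

theorem tsum_bind_mul {α β : Type*} (μ : PMF α) (κ : α → PMF β) (g : β → ℝ≥0∞) :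
    ∑' b, μ.bind κ b * g b = ∑' a, μ a * ∑' b, κ a b * g b := by
  simp only [PMF.bind_apply, ← ENNReal.tsum_mul_right, ← ENNReal.tsum_mul_left]
  rw [ENNReal.tsum_comm]
  simp only [mul_assoc]

theorem tsum_map_mul {α β : Type*} (μ : PMF α) (f : α → β) (g : β → ℝ≥0∞) :
    ∑' b, μ.map f b * g b = ∑' a, μ a * g (f a) := by
  rw [PMF.map, tsum_bind_mul]
  refine tsum_congr fun a => ?_
  rw [tsum_eq_single (f a) (by simp +contextual [PMF.pure_apply])]
  simp

/-- Because `d ≤ n + 1`, exactly `d` of the labels lie below `d`. Working with sums in `ℝ≥0∞`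
postpones every question of summability. -/
theorem tsum_degreeStep {p : ℝ} (hp : p ∈ Icc (0 : ℝ) 1) {n d : ℕ} (hd : d ≤ n + 1)
    {g : ℕ → ℝ} (hg : ∀ d, 0 ≤ g d) :
    ∑' e, degreeStep p hp n d e * ENNReal.ofReal (g e) =
      ENNReal.ofReal ((d * p * g (d + 1) + (n + 1 - d * p) * g d) / (n + 1)) := by
  have h1 : ∀ j : Fin (n + 1),
      ∑' b, coin p hp b * ENNReal.ofReal (g (if b && decide (j.val < d) then d + 1 else d)) =
        ENNReal.ofReal (g d + if j.val < d then p * (g (d + 1) - g d) else 0) := by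
    intro j
    have h0 := hp.1
    have h1 : 0 ≤ 1 - p := sub_nonneg.2 hp.2
    have hd0 := hg d
    have hd1 := hg (d + 1)
    rw [tsum_fintype, Fintype.sum_bool]
    simp only [coin, PMF.ofFintype_apply]
    rw [← ENNReal.ofReal_mul (by simpa using h0), ← ENNReal.ofReal_mul (by simpa using h1),
      ← ENNReal.ofReal_add (by simpa using mul_nonneg h0 (hg _))
        (by simpa using mul_nonneg h1 hd0)]
    congr 1
    by_cases hj : j.val < d <;> simp [hj] <;> ring
  rw [degreeStep, tsum_bind_mul]
  simp only [tsum_map_mul, h1, PMF.uniformOfFintype_apply, Fintype.card_fin]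
  rw [tsum_fintype, ← Finset.mul_sum, ← ENNReal.ofReal_sum_of_nonneg]
  · rw [Finset.sum_add_distrib, Finset.sum_ite, Finset.sum_const_zero, add_zero, Finset.sum_const,
      Finset.sum_const, Fin.card_filter_val_lt, min_eq_right hd, Finset.card_univ, Fintype.card_fin]
    have : ((n + 1 : ℕ) : ℝ≥0∞)⁻¹ = ENNReal.ofReal ((n + 1 : ℝ)⁻¹) := by
      rw [ENNReal.ofReal_inv_of_pos (by positivity)]
      congr 1
      rw [← Nat.cast_succ, ENNReal.ofReal_natCast]
    rw [this, ← ENNReal.ofReal_mul (by positivity)]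
    congr 1
    simp only [nsmul_eq_mul]
    push_cast
    field_simp
    ring
  · intro j _
    have h0 := hp.1
    have h1 : 0 ≤ 1 - p := sub_nonneg.2 hp.2
    have hd0 := hg d
    have hd1 := hg (d + 1)
    split_ifs
    · nlinarith [mul_nonneg h0 hd1, mul_nonneg h1 hd0]
    · simpa using hd0

theorem degree_le_of_mem_support {p : ℝ} (hp : p ∈ Icc (0 : ℝ) 1) (n : ℕ) :
    ∀ d ∈ (degreeLaw p hp n).support, d ≤ n + 1 := by
  induction n with
  | zero => simp [degreeLaw]
  | succ n ih =>
    intro d hd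
    simp only [degreeLaw, degreeStep, PMF.mem_support_bind_iff, PMF.mem_support_map_iff] at hd
    obtain ⟨d', hd', j, -, b, -, rfl⟩ := hd
    have := ih d' hd'
    split_ifs <;> omega

/-- Rising factorials are eigenfunctions of the step, so each step contributes one factor of the
product in `risingMoment`. -/
theorem tsum_degreeLaw_ascFactorial {p : ℝ} (hp : p ∈ Icc (0 : ℝ) 1) (r n : ℕ) :
    ∑' d, degreeLaw p hp n d * ENNReal.ofReal (d.ascFactorial r) =
      ENNReal.ofReal (risingMoment p r n) := by
  induction n with
  | zero =>
    rw [tsum_eq_single 1 (by simp +contextual [degreeLaw, PMF.pure_apply])]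
    simp [degreeLaw, risingMoment, Nat.one_ascFactorial]
  | succ n ih =>
    rw [degreeLaw, tsum_bind_mul]
    have : ∀ d, degreeLaw p hp n d *
        ∑' e, degreeStep p hp n d e * ENNReal.ofReal (e.ascFactorial r) =
        degreeLaw p hp n d * ENNReal.ofReal (d.ascFactorial r) *
          ENNReal.ofReal ((n + 1 + r * p) / (n + 1)) := by
      intro d
      by_cases hd : d ∈ (degreeLaw p hp n).support
      · rw [tsum_degreeStep hp (degree_le_of_mem_support hp n d hd)
          (g := fun d => (d.ascFactorial r : ℝ)) (fun d => by positivity), mul_assoc (degreeLaw p hp n d),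
          ← ENNReal.ofReal_mul (by positivity)]
        congr 2
        -- This is the eigenfunction identity: the increment of the rising factorial, multiplied by
        -- `d`, is `r` times the rising factorial itself.
        have h : (d : ℝ) * (d + 1).ascFactorial r = (d + r) * d.ascFactorial r := by
          exact_mod_cast Nat.succ_ascFactorial d r
        field_simp
        linear_combination p * h
      · rw [PMF.mem_support_iff, not_not] at hd
        simp [hd]
    simp_rw [this]
    rw [ENNReal.tsum_mul_right, ih, ← ENNReal.ofReal_mul (risingMoment_nonneg hp.1 r n)]
    congr 1
    rw [risingMoment, risingMoment, Finset.prod_range_succ, mul_assoc]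

theorem integrable_and_integral_ascFactorial {p : ℝ} (hp : p ∈ Icc (0 : ℝ) 1) (r n : ℕ) :
    Integrable (fun d : ℕ => (d.ascFactorial r : ℝ)) (degreeLaw p hp n).toMeasure ∧
      ∫ d : ℕ, (d.ascFactorial r : ℝ) ∂(degreeLaw p hp n).toMeasure = risingMoment p r n := by
  have h : ∫⁻ d : ℕ, ENNReal.ofReal (d.ascFactorial r) ∂(degreeLaw p hp n).toMeasure =
      ENNReal.ofReal (risingMoment p r n) := by
    rw [lintegral_countable', ← tsum_degreeLaw_ascFactorial hp]
    refine tsum_congr fun d => ?_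
    rw [PMF.toMeasure_apply_singleton _ _ (measurableSet_singleton d), mul_comm]
  have hnn : 0 ≤ᵐ[(degreeLaw p hp n).toMeasure] fun d : ℕ => (d.ascFactorial r : ℝ) :=
    ae_of_all _ fun d => by positivity
  constructor
  · rw [← lintegral_ofReal_ne_top_iff_integrable (by fun_prop) hnn, h]
    exact ENNReal.ofReal_ne_top
  · rw [integral_eq_lintegral_of_nonneg_ae hnn (by fun_prop), h,
      ENNReal.toReal_ofReal (risingMoment_nonneg hp.1 r n)]

theorem tendsto_prod_div_rpow {s : ℝ} (hs : 0 ≤ s) :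
    Tendsto (fun n : ℕ => (∏ k ∈ Finset.range n, ((k + 1 + s) / (k + 1))) / ((n + 1 : ℕ) : ℝ) ^ s)
      atTop (𝓝 (1 / Real.Gamma (s + 1))) := by
  have hG : Real.Gamma (s + 1) ≠ 0 := (Real.Gamma_pos_of_pos (by linarith)).ne'
  have h1 : Tendsto (fun n : ℕ => ((n : ℝ) / (n + 1)) * ((n : ℝ) / (n + 1 + 1)) ^ s *
      (1 / Real.GammaSeq (s + 1) n)) atTop (𝓝 (1 * 1 ^ s * (1 / Real.Gamma (s + 1)))) := by
    have ht : Tendsto (fun n : ℕ => (n : ℝ) / (n + 1)) atTop (𝓝 1) :=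
      tendsto_natCast_div_add_atTop (1 : ℝ)
    have ht2 : Tendsto (fun n : ℕ => (n : ℝ) / (n + 1 + 1)) atTop (𝓝 1) := by
      simpa [add_assoc] using tendsto_natCast_div_add_atTop (1 + 1 : ℝ)
    exact (ht.mul (ht2.rpow_const (Or.inl one_ne_zero))).mul
      (tendsto_const_nhds.div (Real.GammaSeq_tendsto_Gamma (s + 1)) hG)
  rw [Real.one_rpow, one_mul, one_mul] at h1
  -- `Real.GammaSeq (s + 1) n` has `n + 1` factors in its denominator, so it matches the product at
  -- index `n + 1`.
  rw [← tendsto_add_atTop_iff_nat 1]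
  refine h1.congr' ?_
  filter_upwards [eventually_gt_atTop 0] with n hn
  have hn' : (0 : ℝ) < n := by exact_mod_cast hn
  have hP : ∏ j ∈ Finset.range (n + 1), (s + 1 + j : ℝ) ≠ 0 := by
    have : ∀ j : ℕ, 0 < s + 1 + (j : ℝ) := fun j => by positivity
    exact (Finset.prod_pos fun j _ => this j).ne'
  rw [Real.GammaSeq, Finset.prod_div_distrib, Real.div_rpow (by positivity) (by positivity),
    Real.rpow_add_one hn'.ne']
  have hf : ∏ k ∈ Finset.range (n + 1), ((k : ℝ) + 1) = (n + 1) * n.factorial := by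
    rw [← Nat.cast_succ, ← Nat.cast_mul, ← Nat.succ_eq_add_one, ← Nat.factorial_succ,
      ← Finset.prod_range_add_one_eq_factorial]
    push_cast
    rfl
  have hg : ∏ k ∈ Finset.range (n + 1), ((k : ℝ) + 1 + s) =
      ∏ j ∈ Finset.range (n + 1), (s + 1 + j : ℝ) :=
    Finset.prod_congr rfl fun k _ => by ring
  rw [hf, hg]
  have hns : (n : ℝ) ^ s ≠ 0 := (Real.rpow_pos_of_pos hn' s).ne'
  have hns1 : ((n : ℝ) + 1 + 1) ^ s ≠ 0 := (Real.rpow_pos_of_pos (by positivity) s).ne'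
  have hfac : (n.factorial : ℝ) ≠ 0 := by positivity
  push_cast
  field_simp

theorem tendsto_risingMoment {p : ℝ} (hp : 0 ≤ p) (r : ℕ) :
    Tendsto (fun n : ℕ => risingMoment p r n / (((n + 1 : ℕ) : ℝ) ^ p) ^ r) atTop
      (𝓝 (r.factorial / Real.Gamma (r * p + 1))) := by
  have h := (tendsto_prod_div_rpow (s := r * p) (by positivity)).const_mul (r.factorial : ℝ)
  rw [mul_one_div] at h
  refine h.congr fun n => ?_
  rw [risingMoment, ← Real.rpow_mul_natCast (by positivity), mul_comm p, mul_div_assoc]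

/-- The error term has order `r` only, so after division by the `(r + 1)`-st power of the scale it
disappears in the limit. -/
theorem ascFactorial_succ_le (d r : ℕ) :
    d.ascFactorial (r + 1) ≤ d ^ (r + 1) + (r + 1) * r * d.ascFactorial r := by
  induction r with
  | zero => simp [Nat.ascFactorial_succ]
  | succ r ih =>
    rw [Nat.ascFactorial_succ]
    have h : d * d.ascFactorial r ≤ d.ascFactorial (r + 1) := by
      rw [Nat.ascFactorial_succ]
      gcongr
      omega
    calc (d + (r + 1)) * d.ascFactorial (r + 1)
        = d * d.ascFactorial (r + 1) + (r + 1) * d.ascFactorial (r + 1) := by ring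
      _ ≤ d * (d ^ (r + 1) + (r + 1) * r * d.ascFactorial r) +
          (r + 1) * d.ascFactorial (r + 1) := by gcongr
      _ = d ^ (r + 1 + 1) + (r + 1) * r * (d * d.ascFactorial r) +
          (r + 1) * d.ascFactorial (r + 1) := by ring
      _ ≤ d ^ (r + 1 + 1) + (r + 1) * r * d.ascFactorial (r + 1) +
          (r + 1) * d.ascFactorial (r + 1) := by gcongr
      _ ≤ d ^ (r + 1 + 1) + (r + 1 + 1) * (r + 1) * d.ascFactorial (r + 1) := by
          nlinarith [Nat.zero_le (d.ascFactorial (r + 1))]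

theorem pow_le_ascFactorial (d r : ℕ) : d ^ r ≤ d.ascFactorial r := by
  induction r with
  | zero => simp
  | succ r ih =>
    rw [Nat.ascFactorial_succ, pow_succ, mul_comm]
    gcongr
    omega

theorem integrable_pow_degreeLaw {p : ℝ} (hp : p ∈ Icc (0 : ℝ) 1) (r n : ℕ) :
    Integrable (fun d : ℕ => (d : ℝ) ^ r) (degreeLaw p hp n).toMeasure := by
  refine (integrable_and_integral_ascFactorial hp r n).1.mono' (by fun_prop)
    (ae_of_all _ fun d => ?_)
  rw [Real.norm_of_nonneg (by positivity)]
  exact_mod_cast pow_le_ascFactorial d r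

/-- A squeeze: the power is at most the rising factorial, and falls short of it by a rising
factorial of one order less, whose normalized expectation carries an additional factor `(n + 1) ^
(-p)`. -/
theorem tendsto_integral_pow_degreeLaw {p : ℝ} (hp : p ∈ Ioo (0 : ℝ) 1) (r : ℕ) :
    Tendsto (fun n : ℕ => ∫ d : ℕ, ((d : ℝ) / ((n + 1 : ℕ) : ℝ) ^ p) ^ r
      ∂(degreeLaw p (Ioo_subset_Icc_self hp) n).toMeasure) atTop
      (𝓝 (r.factorial / Real.Gamma (r * p + 1))) := by
  have hp' := Ioo_subset_Icc_self hp
  simp_rw [div_pow, integral_div]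
  have hpos : ∀ n : ℕ, 0 < ((n + 1 : ℕ) : ℝ) ^ p := fun n =>
    Real.rpow_pos_of_pos (by positivity) p
  cases r with
  | zero => simp
  | succ r =>
    have hupper := tendsto_risingMoment hp.1.le (r + 1)
    have hinv : Tendsto (fun n : ℕ => (((n + 1 : ℕ) : ℝ) ^ p)⁻¹) atTop (𝓝 0) :=
      ((tendsto_rpow_atTop hp.1).comp
        (tendsto_natCast_atTop_atTop.comp (tendsto_add_atTop_nat 1))).inv_tendsto_atTop
    have hlower := hupper.sub (((tendsto_risingMoment hp.1.le r).const_mul ((r + 1) * r : ℝ)).mul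
      hinv)
    rw [mul_zero, sub_zero] at hlower
    refine tendsto_of_tendsto_of_tendsto_of_le_of_le hlower hupper (fun n => ?_) fun n => ?_
    · have hint := integrable_pow_degreeLaw hp' (r + 1) n
      obtain ⟨i1, e1⟩ := integrable_and_integral_ascFactorial hp' (r + 1) n
      obtain ⟨i0, e0⟩ := integrable_and_integral_ascFactorial hp' r n
      have hle : ∫ d : ℕ, (d.ascFactorial (r + 1) : ℝ) ∂(degreeLaw p hp' n).toMeasure ≤
          ∫ d : ℕ, ((d : ℝ) ^ (r + 1) + (r + 1) * r * (d.ascFactorial r : ℝ))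
            ∂(degreeLaw p hp' n).toMeasure := by
        refine integral_mono i1 (hint.add (i0.const_mul _)) fun d => ?_
        simp only
        exact_mod_cast ascFactorial_succ_le d r
      rw [integral_add hint (i0.const_mul _), integral_const_mul, e0, e1] at hle
      have := hpos n
      show risingMoment p (r + 1) n / (((n + 1 : ℕ) : ℝ) ^ p) ^ (r + 1) -
        (r + 1) * r * (risingMoment p r n / (((n + 1 : ℕ) : ℝ) ^ p) ^ r) *
          (((n + 1 : ℕ) : ℝ) ^ p)⁻¹ ≤ _
      have heq : risingMoment p (r + 1) n / (((n + 1 : ℕ) : ℝ) ^ p) ^ (r + 1) -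
        (r + 1) * r * (risingMoment p r n / (((n + 1 : ℕ) : ℝ) ^ p) ^ r) *
          (((n + 1 : ℕ) : ℝ) ^ p)⁻¹ =
        (risingMoment p (r + 1) n - (r + 1) * r * risingMoment p r n) /
          (((n + 1 : ℕ) : ℝ) ^ p) ^ (r + 1) := by
        field_simp
        ring
      rw [heq]
      gcongr
      linarith
    · have := hpos n
      rw [← (integrable_and_integral_ascFactorial hp' (r + 1) n).2]
      refine div_le_div_of_nonneg_right ?_ (by positivity)
      refine integral_mono (integrable_pow_degreeLaw hp' (r + 1) n)
        (integrable_and_integral_ascFactorial hp' (r + 1) n).1 fun d => ?_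
      simp only
      exact_mod_cast pow_le_ascFactorial d (r + 1)

end BernoulliGrowth

namespace BernoulliGrowth

open scoped Topology

/-! ### The method of moments -/

/-- The derivative of the remainder of order `R + 1` is `c` times the remainder of order `R`, so the
bound is integrated from `0`. The values `c = ±I` later cover both signs of the argument. -/
theorem norm_exp_sub_sum_le_of_nonneg {c : ℂ} (hc : c.re = 0) (hc1 : ‖c‖ = 1) (R : ℕ) :
    ∀ x : ℝ, 0 ≤ x →
      ‖Complex.exp (x * c) - ∑ r ∈ Finset.range R, (x * c) ^ r / (r.factorial : ℂ)‖ ≤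
        x ^ R / R.factorial := by
  induction R with
  | zero =>
    intro x _
    simp [Complex.norm_exp, hc]
  | succ R ih =>
    intro x hx
    have hd : ∀ y : ℝ, HasDerivAt (fun y : ℝ => Complex.exp (y * c) -
        ∑ r ∈ Finset.range (R + 1), (y * c) ^ r / (r.factorial : ℂ))
        (c * (Complex.exp (y * c) - ∑ r ∈ Finset.range R, (y * c) ^ r / (r.factorial : ℂ))) y := by
      intro y
      have hy : HasDerivAt (fun y : ℝ => (y : ℂ) * c) c y := by
        simpa using (Complex.ofRealCLM.hasDerivAt (x := y)).mul_const c
      have h := hy.cexp.sub (HasDerivAt.fun_sum (u := Finset.range (R + 1))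
        fun r _ => (hy.pow r).div_const (r.factorial : ℂ))
      refine h.congr_deriv ?_
      rw [Finset.sum_range_succ', mul_sub, Finset.mul_sum]
      simp only [Nat.cast_zero, zero_mul, zero_div, add_zero, Nat.add_sub_cancel]
      congr 1
      · ring
      · refine Finset.sum_congr rfl fun r _ => ?_
        rw [Nat.factorial_succ]
        have : (r.factorial : ℂ) ≠ 0 := by exact_mod_cast r.factorial_ne_zero
        have : (r + 1 : ℂ) ≠ 0 := by exact_mod_cast r.succ_ne_zero
        push_cast
        field_simp
    have hB : ∀ y : ℝ, HasDerivAt (fun y : ℝ => y ^ (R + 1) / ((R + 1).factorial : ℝ))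
        (y ^ R / R.factorial) y := by
      intro y
      refine ((hasDerivAt_pow (R + 1) y).div_const ((R + 1).factorial : ℝ)).congr_deriv ?_
      rw [Nat.factorial_succ]
      have : (R.factorial : ℝ) ≠ 0 := by positivity
      push_cast
      field_simp
    refine image_norm_le_of_norm_deriv_right_le_deriv_boundary (a := 0) (b := x)
      (fun y _ => (hd y).continuousAt.continuousWithinAt) (fun y _ => (hd y).hasDerivWithinAt)
      ?_ (fun y => hB y) (fun y hy => ?_) ⟨hx, le_rfl⟩
    · simp [Finset.sum_range_succ']
    · rw [norm_mul, hc1, one_mul]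
      exact ih y hy.1

theorem norm_exp_mul_I_sub_sum_le (x : ℝ) (R : ℕ) :
    ‖Complex.exp (x * Complex.I) - ∑ r ∈ Finset.range R, (x * Complex.I) ^ r / (r.factorial : ℂ)‖ ≤
      |x| ^ R / R.factorial := by
  rcases le_total 0 x with hx | hx
  · rw [abs_of_nonneg hx]
    exact norm_exp_sub_sum_le_of_nonneg (by simp) (by simp) R x hx
  · have h := norm_exp_sub_sum_le_of_nonneg (c := -Complex.I) (by simp) (by simp) R (-x)
      (by linarith)
    rw [abs_of_nonpos hx]
    simpa using h

/-- The Taylor polynomial of a characteristic function with prescribed moments. -/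
noncomputable def momentPolynomial (m : ℕ → ℝ) (t : ℝ) (R : ℕ) : ℂ :=
  ∑ r ∈ Finset.range R, (t * Complex.I) ^ r / (r.factorial : ℂ) * (m r : ℂ)

/-- The order is taken even so that `|x| ^ (2 * k) = x ^ (2 * k)` and the error is controlled by a
moment, not an absolute moment. -/
theorem norm_charFun_sub_momentPolynomial_le (μ : Measure ℝ) [IsProbabilityMeasure μ]
    (hint : ∀ r : ℕ, Integrable (fun x : ℝ => x ^ r) μ) (t : ℝ) (k : ℕ) :
    ‖charFun μ t - momentPolynomial (fun r => ∫ x, x ^ r ∂μ) t (2 * k)‖ ≤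
      t ^ (2 * k) / (2 * k).factorial * ∫ x, x ^ (2 * k) ∂μ := by
  have hi : ∀ r : ℕ, Integrable
      (fun x : ℝ => (t * Complex.I) ^ r / (r.factorial : ℂ) * ((x ^ r : ℝ) : ℂ)) μ :=
    fun r => (hint r).ofReal.const_mul _
  have hP : momentPolynomial (fun r => ∫ x, x ^ r ∂μ) t (2 * k) =
      ∫ x, ∑ r ∈ Finset.range (2 * k),
        (t * Complex.I) ^ r / (r.factorial : ℂ) * ((x ^ r : ℝ) : ℂ) ∂μ := by
    rw [integral_finsetSum _ fun r _ => hi r]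
    refine Finset.sum_congr rfl fun r _ => ?_
    rw [integral_const_mul, integral_complex_ofReal]
  have hexp : Integrable (fun x : ℝ => Complex.exp (t * x * Complex.I)) μ := by
    refine (integrable_const (1 : ℝ)).mono' (by fun_prop) (ae_of_all _ fun x => ?_)
    rw [← Complex.ofReal_mul, Complex.norm_exp_ofReal_mul_I]
  rw [charFun_apply_real, hP, ← integral_sub hexp (integrable_finsetSum _ fun r _ => hi r),
    ← integral_const_mul]
  refine norm_integral_le_of_norm_le ((hint (2 * k)).const_mul _) (ae_of_all _ fun x => ?_)
  have h := norm_exp_mul_I_sub_sum_le (t * x) (2 * k)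
  rw [(even_two_mul k).pow_abs, mul_pow] at h
  convert h using 1
  · congr 2
    · push_cast
      rfl
    · refine Finset.sum_congr rfl fun r _ => ?_
      push_cast
      ring
  · ring

/-- The method of moments, on the level of characteristic functions: the moments of the limit grow
slowly enough for the Taylor series of its characteristic function to converge. -/
theorem tendsto_charFun_of_tendsto_moments {μs : ℕ → Measure ℝ} [∀ n, IsProbabilityMeasure (μs n)]
    {μ : Measure ℝ} [IsProbabilityMeasure μ]
    (hints : ∀ n (r : ℕ), Integrable (fun x : ℝ => x ^ r) (μs n))
    (hint : ∀ r : ℕ, Integrable (fun x : ℝ => x ^ r) μ)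
    (hlim : ∀ r : ℕ, Tendsto (fun n => ∫ x, x ^ r ∂(μs n)) atTop (𝓝 (∫ x, x ^ r ∂μ)))
    (t : ℝ)
    (hsmall : Tendsto (fun k : ℕ => t ^ (2 * k) / (2 * k).factorial * ∫ x, x ^ (2 * k) ∂μ) atTop
      (𝓝 0)) :
    Tendsto (fun n => charFun (μs n) t) atTop (𝓝 (charFun μ t)) := by
  rw [Metric.tendsto_atTop']
  intro ε hε
  -- The order is chosen from the limit alone. Convergence of the single moment of order `2 * k`
  -- then makes the same error bound hold for all large `n`.
  obtain ⟨k, hk⟩ := (hsmall.eventually_lt_const (show 0 < ε / 4 by linarith)).exists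
  have h1 : Tendsto (fun n => momentPolynomial (fun r => ∫ x, x ^ r ∂(μs n)) t (2 * k)) atTop
      (𝓝 (momentPolynomial (fun r => ∫ x, x ^ r ∂μ) t (2 * k))) := by
    refine tendsto_finsetSum _ fun r _ => Tendsto.const_mul _ ?_
    exact (Complex.continuous_ofReal.tendsto _).comp (hlim r)
  have h2 := (hlim (2 * k)).const_mul (t ^ (2 * k) / ((2 * k).factorial : ℝ))
  obtain ⟨N1, hN1⟩ := (Metric.tendsto_atTop.1 h1) (ε / 4) (by linarith)
  obtain ⟨N2, hN2⟩ := eventually_atTop.1 (h2.eventually_lt_const hk)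
  refine ⟨max N1 N2, fun n hn => ?_⟩
  have e1 := hN1 n ((le_max_left _ _).trans hn.le)
  have e2 := hN2 n ((le_max_right _ _).trans hn.le)
  have e3 := norm_charFun_sub_momentPolynomial_le (μs n) (hints n) t k
  have e4 := norm_charFun_sub_momentPolynomial_le μ hint t k
  rw [← dist_eq_norm] at e3 e4
  calc dist (charFun (μs n) t) (charFun μ t) ≤ _ + _ + _ := dist_triangle4 _ _ _ _
    _ < ε := by
      rw [dist_comm] at e4
      linarith

/-- The method of moments applied to the constant sequence `μ` identifies the two characteristic
functions. -/
theorem eq_of_moments_eq {μ ν : Measure ℝ} [IsProbabilityMeasure μ] [IsProbabilityMeasure ν]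
    (hμ : ∀ r : ℕ, Integrable (fun x : ℝ => x ^ r) μ)
    (hν : ∀ r : ℕ, Integrable (fun x : ℝ => x ^ r) ν)
    (h : ∀ r : ℕ, ∫ x, x ^ r ∂μ = ∫ x, x ^ r ∂ν)
    (hsmall : ∀ t : ℝ, Tendsto (fun k : ℕ => t ^ (2 * k) / (2 * k).factorial * ∫ x, x ^ (2 * k) ∂ν)
      atTop (𝓝 0)) : μ = ν := by
  refine Measure.ext_of_charFun (funext fun t => ?_)
  refine tendsto_nhds_unique tendsto_const_nhds (tendsto_charFun_of_tendsto_moments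
    (μs := fun _ => μ) (fun _ => hμ) hν (fun r => ?_) t (hsmall t))
  rw [h r]
  exact tendsto_const_nhds

end BernoulliGrowth

namespace BernoulliGrowth

open scoped Topology
open Complex (I)

/-! ### Contour integrals in the logarithmic plane -/

/-- The integrand `e ^ s s ^ a e ^ (-x s ^ p) ds / s` in the logarithmic coordinate `u = log s`,
where it is entire. -/
noncomputable def logIntegrand (p a x : ℝ) (u : ℂ) : ℂ :=
  Complex.exp (Complex.exp u + a * u - x * Complex.exp (p * u))

theorem norm_logIntegrand (p a x : ℝ) (u : ℂ) :
    ‖logIntegrand p a x u‖ = Real.exp (Real.exp u.re * Real.cos u.im + a * u.re -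
      x * (Real.exp (p * u.re) * Real.cos (p * u.im))) := by
  rw [logIntegrand, Complex.norm_exp]
  simp [Complex.exp_re]

theorem differentiable_logIntegrand (p a x : ℝ) : Differentiable ℂ (logIntegrand p a x) := by
  unfold logIntegrand
  fun_prop

@[fun_prop]
theorem continuous_logIntegrand (p a x : ℝ) : Continuous (logIntegrand p a x) :=
  (differentiable_logIntegrand p a x).continuous

theorem logIntegrand_eq_mul (p a x : ℝ) (u : ℂ) :
    logIntegrand p a x u = logIntegrand p a 0 u * Complex.exp (-(x * Complex.exp (p * u))) := by
  simp only [logIntegrand, ← Complex.exp_add]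
  congr 1
  push_cast
  ring

theorem tendsto_exp_dominates {κ p : ℝ} (hκ : 0 < κ) (hp : p < 1) (a x : ℝ) :
    Tendsto (fun v : ℝ => -κ * Real.exp v + a * v + x * Real.exp (p * v)) atTop atBot := by
  have h1 : Tendsto (fun v : ℝ => -κ + a * (v ^ 1 * Real.exp (-v)) + x * Real.exp (-((1 - p) * v)))
      atTop (𝓝 (-κ + a * 0 + x * 0)) := by
    refine (tendsto_const_nhds.add ((Real.tendsto_pow_mul_exp_neg_atTop_nhds_zero 1).const_mul a)).add
      (Tendsto.const_mul x ?_)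
    exact Real.tendsto_exp_neg_atTop_nhds_zero.comp
      (tendsto_id.const_mul_atTop (by linarith : 0 < 1 - p))
  have h2 := Real.tendsto_exp_atTop.atTop_mul_neg (by simpa using hκ) h1
  refine h2.congr fun v => ?_
  have e1 : Real.exp v * Real.exp (-v) = 1 := by rw [← Real.exp_add]; simp
  have e2 : Real.exp v * Real.exp (-((1 - p) * v)) = Real.exp (p * v) := by
    rw [← Real.exp_add]; congr 1; ring
  linear_combination a * v * e1 + x * e2

/-- For imaginary parts near `π` the sign of `cos (p * u.im)` is not controlled, so it is bounded by
`-1`. For `p < 1` this costs nothing: by `tendsto_exp_dominates` the double exponential wins. -/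
theorem norm_logIntegrand_le {p a x κ : ℝ} (hx : 0 ≤ x) {u : ℂ} (hu : Real.cos u.im ≤ -κ) :
    ‖logIntegrand p a x u‖ ≤
      Real.exp (-κ * Real.exp u.re + a * u.re + x * Real.exp (p * u.re)) := by
  rw [norm_logIntegrand]
  have h1 := mul_le_mul_of_nonneg_left hu (Real.exp_pos u.re).le
  have h2 := mul_le_mul_of_nonneg_left (Real.neg_one_le_cos (p * u.im)) (Real.exp_pos (p * u.re)).le
  have h3 := mul_le_mul_of_nonneg_left h2 hx
  gcongr
  linarith

/-- Two points on a vertical line far to the right, in a range of imaginary parts where `cos` is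
negative, cannot be told apart by a primitive of the integrand. -/
theorem tendsto_primitive_of_re_atTop {p a x κ c d : ℝ} (hp : p < 1) (hx : 0 ≤ x) (hκ : 0 < κ)
    (hcos : ∀ θ ∈ Icc c d, Real.cos θ ≤ -κ) {Φ : ℂ → ℂ}
    (hΦ : ∀ u, HasDerivAt Φ (logIntegrand p a x u) u) {h : ℝ → ℝ}
    (hh : ∀ᶠ v in atTop, h v ∈ Icc c d) {L : ℂ}
    (hL : Tendsto (fun v : ℝ => Φ (v + h v * I)) atTop (𝓝 L)) {u : ℝ → ℂ}
    (hre : Tendsto (fun w => (u w).re) atTop atTop) (him : ∀ᶠ w in atTop, (u w).im ∈ Icc c d) :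
    Tendsto (fun w => Φ (u w)) atTop (𝓝 L) := by
  have h1 : Tendsto (fun w => Φ ((u w).re + h (u w).re * I)) atTop (𝓝 L) := hL.comp hre
  have h2 : Tendsto (fun w => Φ (u w) - Φ ((u w).re + h (u w).re * I)) atTop (𝓝 0) := by
    have hB : Tendsto (fun w => Real.exp (-κ * Real.exp (u w).re + a * (u w).re +
        x * Real.exp (p * (u w).re)) * (d - c)) atTop (𝓝 0) := by
      simpa using ((Real.tendsto_exp_atBot.comp (tendsto_exp_dominates hκ hp a x)).comp
        hre).mul_const (d - c)
    refine squeeze_zero_norm' ?_ hB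
    filter_upwards [him, hre.eventually hh] with w hw hw'
    -- The mean value inequality is applied on a vertical segment of length at most `d - c`, on
    -- which the derivative of `Φ` is uniformly small.
    have hconv : Convex ℝ {z : ℂ | z.re = (u w).re ∧ z.im ∈ Icc c d} := by
      have : {z : ℂ | z.re = (u w).re ∧ z.im ∈ Icc c d} =
          (Complex.reLm ⁻¹' {(u w).re}) ∩ (Complex.imLm ⁻¹' Icc c d) := by
        ext z; simp
      rw [this]
      exact ((convex_singleton _).linear_preimage _).inter ((convex_Icc c d).linear_preimage _)
    have hmv := hconv.norm_image_sub_le_of_norm_hasDerivWithin_le (f := Φ)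
      (f' := logIntegrand p a x)
      (C := Real.exp (-κ * Real.exp (u w).re + a * (u w).re + x * Real.exp (p * (u w).re)))
      (x := (u w).re + h (u w).re * I) (y := u w)
      (fun z _ => (hΦ z).hasDerivWithinAt) (fun z hz => by
        have := norm_logIntegrand_le (p := p) (a := a) hx (hcos _ hz.2)
        rwa [hz.1] at this) (by simpa using hw') ⟨rfl, hw⟩
    refine hmv.trans (mul_le_mul_of_nonneg_left ?_ (Real.exp_pos _).le)
    have : u w - ((u w).re + h (u w).re * I) = (((u w).im - h (u w).re : ℝ) : ℂ) * I := by
      apply Complex.ext <;> simp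
    rw [this, norm_mul, Complex.norm_I, mul_one, Complex.norm_real, Real.norm_eq_abs, abs_le]
    constructor <;> linarith [hw.1, hw.2, hw'.1, hw'.2]
  simpa using h2.add h1

theorem tendsto_sq_cocompact : Tendsto (fun y : ℝ => y ^ 2) (cocompact ℝ) atTop :=
  ((tendsto_pow_atTop two_ne_zero).comp (tendsto_norm_cocompact_atTop (E := ℝ))).congr fun y => by
    simp

/-- The opening of the contour: `1 < opening p < 2` and `p * opening p < 1`. -/
noncomputable def opening (p : ℝ) : ℝ := (3 - p) / 2

/-- A smooth contour in the logarithmic plane whose ends are asymptotic to the lines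
`Im u = ± opening p * π / 2`. -/
noncomputable def contour (p y : ℝ) : ℂ := (y ^ 2 : ℝ) + (opening p * Real.arctan y : ℝ) * I

/-- The derivative of `contour`. -/
noncomputable def contourDeriv (p y : ℝ) : ℂ := (2 * y : ℝ) + (opening p / (1 + y ^ 2) : ℝ) * I

/-- The integral of `logIntegrand` along `contour`. -/
noncomputable def contourIntegral (p a x : ℝ) : ℂ :=
  ∫ y : ℝ, logIntegrand p a x (contour p y) * contourDeriv p y

@[simp] theorem contour_re (p y : ℝ) : (contour p y).re = y ^ 2 := by
  simp [contour, -Complex.ofReal_mul, -Complex.ofReal_pow]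

@[simp] theorem contour_im (p y : ℝ) : (contour p y).im = opening p * Real.arctan y := by
  simp [contour, -Complex.ofReal_mul, -Complex.ofReal_pow]

theorem hasDerivAt_contour (p y : ℝ) : HasDerivAt (contour p) (contourDeriv p y) y := by
  have h1 : HasDerivAt (fun y : ℝ => ((y ^ 2 : ℝ) : ℂ)) ((2 * y : ℝ) : ℂ) y := by
    simpa using (hasDerivAt_pow 2 y).ofReal_comp
  have h2 : HasDerivAt (fun y : ℝ => ((opening p * Real.arctan y : ℝ) : ℂ))
      ((opening p / (1 + y ^ 2) : ℝ) : ℂ) y := by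
    have := ((Real.hasDerivAt_arctan y).const_mul (opening p)).ofReal_comp
    simpa [div_eq_mul_inv] using this
  exact h1.add (h2.mul_const I)

@[fun_prop]
theorem continuous_contour (p : ℝ) : Continuous (contour p) :=
  continuous_iff_continuousAt.2 fun y => (hasDerivAt_contour p y).continuousAt

@[fun_prop]
theorem continuous_contourDeriv (p : ℝ) : Continuous (contourDeriv p) := by
  unfold contourDeriv
  have : Continuous fun y : ℝ => opening p / (1 + y ^ 2) :=
    continuous_const.div (by fun_prop) fun y => by positivity
  fun_prop

theorem abs_arctan_lt (y : ℝ) : |Real.arctan y| < Real.pi / 2 :=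
  abs_lt.2 ⟨Real.neg_pi_div_two_lt_arctan y, Real.arctan_lt_pi_div_two y⟩

/-- The angle halfway between `π / 2` and the imaginary part `opening p * π / 2` of the upper asymptote
of the contour. -/
noncomputable def contourAngle (p : ℝ) : ℝ := (1 + opening p) / 2 * (Real.pi / 2)

theorem opening_pos {p : ℝ} (hp : p ∈ Ioo (0 : ℝ) 1) : 0 < opening p := by unfold opening; linarith [hp.2]

theorem opening_lt_two {p : ℝ} (hp : p ∈ Ioo (0 : ℝ) 1) : opening p < 2 := by unfold opening; linarith [hp.1]

theorem one_lt_opening {p : ℝ} (hp : p ∈ Ioo (0 : ℝ) 1) : 1 < opening p := by unfold opening; linarith [hp.2]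

/-- Equivalent to `(1 - p) (2 - p) > 0`. It keeps `p * u` in the strip where `Re (exp (p * u))` is
positive for `u` on the contour, while `1 < opening p` makes `exp (exp u)` decay at the ends. -/
theorem mul_opening_lt_one {p : ℝ} (hp : p ∈ Ioo (0 : ℝ) 1) : p * opening p < 1 := by
  unfold opening; nlinarith [hp.1, hp.2, mul_pos (sub_pos.2 hp.2) (sub_pos.2 hp.2)]

theorem cos_contourAngle_neg {p : ℝ} (hp : p ∈ Ioo (0 : ℝ) 1) : Real.cos (contourAngle p) < 0 := by
  have := one_lt_opening hp
  have := opening_lt_two hp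
  apply Real.cos_neg_of_pi_div_two_lt_of_lt <;> unfold contourAngle <;> nlinarith [Real.pi_pos]

theorem contourAngle_lt_pi {p : ℝ} (hp : p ∈ Ioo (0 : ℝ) 1) : contourAngle p < Real.pi := by
  have := opening_lt_two hp
  unfold contourAngle; nlinarith [Real.pi_pos]

theorem contourAngle_pos {p : ℝ} (hp : p ∈ Ioo (0 : ℝ) 1) : 0 < contourAngle p := by
  have := one_lt_opening hp
  unfold contourAngle; nlinarith [Real.pi_pos]

theorem cos_le_of_mem_upper {p : ℝ} (hp : p ∈ Ioo (0 : ℝ) 1) {θ : ℝ} (h : θ ∈ Icc (contourAngle p) Real.pi) :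
    Real.cos θ ≤ - -Real.cos (contourAngle p) := by
  rw [neg_neg]
  exact Real.cos_le_cos_of_nonneg_of_le_pi (contourAngle_pos hp).le h.2 h.1

theorem cos_le_of_mem_lower {p : ℝ} (hp : p ∈ Ioo (0 : ℝ) 1) {θ : ℝ} (h : θ ∈ Icc (-Real.pi) (-contourAngle p)) :
    Real.cos θ ≤ - -Real.cos (contourAngle p) := by
  rw [← Real.cos_neg]
  exact cos_le_of_mem_upper hp ⟨by linarith [h.2], by linarith [h.1]⟩

theorem eventually_contour_im_mem {p : ℝ} (hp : p ∈ Ioo (0 : ℝ) 1) : ∀ᶠ y in atTop,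
    opening p * Real.arctan y ∈ Icc (contourAngle p) Real.pi := by
  have hb := opening_pos hp
  have h1 := one_lt_opening hp
  have h2 := opening_lt_two hp
  have h : Tendsto (fun y => opening p * Real.arctan y) atTop (𝓝 (opening p * (Real.pi / 2))) :=
    ((Real.tendsto_arctan_atTop).mono_right nhdsWithin_le_nhds).const_mul _
  have hlt : contourAngle p < opening p * (Real.pi / 2) := by
    unfold contourAngle
    nlinarith [Real.pi_pos]
  filter_upwards [h.eventually_const_lt hlt] with y hy
  refine ⟨hy.le, ?_⟩
  have := mul_le_mul_of_nonneg_left (abs_lt.1 (abs_arctan_lt y)).2.le hb.le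
  nlinarith [Real.pi_pos]

theorem cos_opening_pos {p : ℝ} (hp : p ∈ Ioo (0 : ℝ) 1) :
    0 < Real.cos (p * opening p * (Real.pi / 2)) := by
  have hb := mul_pos hp.1 (opening_pos hp)
  have hb1 := mul_opening_lt_one hp
  refine Real.cos_pos_of_mem_Ioo ⟨?_, ?_⟩ <;> nlinarith [Real.pi_pos]

/-- The exponential rate of decay in `x` of the integrand on the contour shifted by `l`. -/
noncomputable def decayRate (p l : ℝ) : ℝ :=
  Real.exp (p * l) * Real.cos (p * opening p * (Real.pi / 2))

theorem decayRate_pos {p : ℝ} (hp : p ∈ Ioo (0 : ℝ) 1) (l : ℝ) : 0 < decayRate p l :=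
  mul_pos (Real.exp_pos _) (cos_opening_pos hp)

/-- On the shifted contour `Re u ≥ l` and `|Im (p * u)| < p * opening p * π / 2 < π / 2`, so `Re
(exp (p * u))` is at least `decayRate p l`. -/
theorem norm_logIntegrand_contour_le {p : ℝ} (hp : p ∈ Ioo (0 : ℝ) 1) {a x : ℝ} (hx : 0 ≤ x)
    (l y : ℝ) : ‖logIntegrand p a x (contour p y + l)‖ ≤
      Real.exp (-(decayRate p l * x)) * ‖logIntegrand p a 0 (contour p y + l)‖ := by
  rw [logIntegrand_eq_mul, norm_mul, mul_comm]
  gcongr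
  rw [Complex.norm_exp]
  have hb := mul_pos hp.1 (opening_pos hp)
  have hb1 := mul_opening_lt_one hp
  have hc : Real.cos (p * opening p * (Real.pi / 2)) ≤ Real.cos (p * (opening p * Real.arctan y)) := by
    rw [← Real.cos_abs (p * (opening p * Real.arctan y)), ← mul_assoc, abs_mul, abs_of_pos hb]
    refine Real.cos_le_cos_of_nonneg_of_le_pi (by positivity) ?_ ?_
    · nlinarith [Real.pi_pos]
    · exact mul_le_mul_of_nonneg_left (abs_arctan_lt y).le hb.le
  have hc0 := cos_opening_pos hp
  have h1 : Real.exp (p * l) ≤ Real.exp (p * (y ^ 2 + l)) := by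
    rw [Real.exp_le_exp]
    nlinarith [mul_nonneg hp.1.le (sq_nonneg y)]
  have h2 : decayRate p l ≤
      Real.exp (p * (y ^ 2 + l)) * Real.cos (p * (opening p * Real.arctan y)) :=
    mul_le_mul h1 hc hc0.le (Real.exp_pos _).le
  simp only [Complex.neg_re, Complex.mul_re, Complex.ofReal_re, Complex.exp_re, Complex.ofReal_im,
    contour_re, contour_im, Complex.mul_im, zero_mul, sub_zero, add_zero, Complex.add_re,
    Complex.add_im]
  rw [Real.exp_le_exp]
  nlinarith

theorem eventually_norm_logIntegrand_contour_le {p : ℝ} (hp : p ∈ Ioo (0 : ℝ) 1) (a l : ℝ) :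
    ∀ᶠ y in cocompact ℝ, ‖logIntegrand p a 0 (contour p y + l)‖ ≤ Real.exp (-l) * Real.exp (-y ^ 2) := by
  have hκ : 0 < -Real.cos (contourAngle p) := neg_pos.2 (cos_contourAngle_neg hp)
  have hsq := tendsto_sq_cocompact
  -- Using `a + 1` in place of `a` gains the factor `exp (-(y ^ 2 + l))`.
  have h1 := ((tendsto_exp_dominates hκ hp.2 (a + 1) 0).comp
    (tendsto_atTop_add_const_right _ l hsq)).eventually_le_atBot 0
  have h2 := (tendsto_norm_cocompact_atTop (E := ℝ)).eventually (eventually_contour_im_mem hp)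
  filter_upwards [h1, h2] with y hy hy'
  have hcos : Real.cos (contour p y + l).im ≤ - -Real.cos (contourAngle p) := by
    rw [Complex.add_im, contour_im, Complex.ofReal_im, add_zero]
    rcases le_total 0 y with h | h
    · rw [Real.norm_of_nonneg h] at hy'
      exact cos_le_of_mem_upper hp hy'
    · rw [Real.norm_of_nonpos h, Real.arctan_neg, mul_neg] at hy'
      rw [← Real.cos_neg]
      exact cos_le_of_mem_upper hp hy'
  refine (norm_logIntegrand_le le_rfl hcos).trans ?_
  rw [Complex.add_re, contour_re, Complex.ofReal_re, ← Real.exp_add, Real.exp_le_exp]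
  simp only [Function.comp_apply] at hy
  linarith

theorem tendsto_logIntegrand_contour {p : ℝ} (hp : p ∈ Ioo (0 : ℝ) 1) (a : ℝ) :
    Tendsto (fun y => logIntegrand p a 0 (contour p y)) (cocompact ℝ) (𝓝 0) := by
  refine squeeze_zero_norm' (a := fun y => Real.exp (-y ^ 2)) ?_ ?_
  · simpa using eventually_norm_logIntegrand_contour_le hp a 0
  · exact Real.tendsto_exp_neg_atTop_nhds_zero.comp tendsto_sq_cocompact

theorem integrable_shifted_contour_zero {p : ℝ} (hp : p ∈ Ioo (0 : ℝ) 1) (a l : ℝ) :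
    Integrable fun y : ℝ => logIntegrand p a 0 (contour p y + l) * contourDeriv p y := by
  have hg : Integrable fun y : ℝ => (2 * ‖y * Real.exp (-1 * y ^ 2)‖ + 2 * Real.exp (-1 * y ^ 2)) :=
    ((integrable_mul_exp_neg_mul_sq one_pos).norm.const_mul 2).add
      ((integrable_exp_neg_mul_sq one_pos).const_mul 2)
  refine (Continuous.locallyIntegrable (by fun_prop)).integrable_of_isBigO_cocompact
    (g := fun y : ℝ => (2 * ‖y * Real.exp (-1 * y ^ 2)‖ + 2 * Real.exp (-1 * y ^ 2)))
    (Asymptotics.IsBigO.of_bound (Real.exp (-l)) ?_) (hg.integrableAtFilter _)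
  filter_upwards [eventually_norm_logIntegrand_contour_le hp a l] with y hy
  rw [norm_mul, Real.norm_of_nonneg (by positivity), norm_mul, Real.norm_of_nonneg
    (Real.exp_pos _).le, neg_one_mul]
  have hd : ‖contourDeriv p y‖ ≤ 2 * ‖y‖ + 2 := by
    refine (norm_add_le _ _).trans ?_
    rw [norm_mul, Complex.norm_I, mul_one, Complex.norm_real, Complex.norm_real, norm_mul]
    refine add_le_add (by simp) ?_
    have hb := opening_pos hp
    rw [Real.norm_of_nonneg (by positivity)]
    exact (div_le_self hb.le (by nlinarith [sq_nonneg y])).trans (opening_lt_two hp).le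
  calc _ ≤ Real.exp (-l) * Real.exp (-y ^ 2) * (2 * ‖y‖ + 2) := by gcongr
    _ = _ := by ring

theorem integrable_contour_zero {p : ℝ} (hp : p ∈ Ioo (0 : ℝ) 1) (a : ℝ) :
    Integrable fun y : ℝ => logIntegrand p a 0 (contour p y) * contourDeriv p y := by
  simpa using integrable_shifted_contour_zero hp a 0

theorem norm_shifted_contour_integrand_le {p : ℝ} (hp : p ∈ Ioo (0 : ℝ) 1) {a x : ℝ} (hx : 0 ≤ x)
    (l y : ℝ) : ‖logIntegrand p a x (contour p y + l) * contourDeriv p y‖ ≤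
      Real.exp (-(decayRate p l * x)) *
        ‖logIntegrand p a 0 (contour p y + l) * contourDeriv p y‖ := by
  rw [norm_mul, norm_mul, ← mul_assoc]
  gcongr
  exact norm_logIntegrand_contour_le hp hx l y

theorem norm_contour_integrand_le {p : ℝ} (hp : p ∈ Ioo (0 : ℝ) 1) {a x : ℝ} (hx : 0 ≤ x) (y : ℝ) :
    ‖logIntegrand p a x (contour p y) * contourDeriv p y‖ ≤
      Real.exp (-(decayRate p 0 * x)) *
        ‖logIntegrand p a 0 (contour p y) * contourDeriv p y‖ := by
  simpa using norm_shifted_contour_integrand_le hp (a := a) hx 0 y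

theorem integrable_shifted_contour {p : ℝ} (hp : p ∈ Ioo (0 : ℝ) 1) (a : ℝ) {x : ℝ} (hx : 0 ≤ x)
    (l : ℝ) : Integrable fun y : ℝ => logIntegrand p a x (contour p y + l) * contourDeriv p y :=
  ((integrable_shifted_contour_zero hp a l).norm.const_mul _).mono' (by fun_prop)
    (ae_of_all _ fun y => norm_shifted_contour_integrand_le hp hx l y)

/-- A primitive of the integrand has limits at the two ends of the contour, which can be computed
along any path to infinity that stays in the left half of the logarithmic strip. -/
theorem exists_primitive_with_limits {p : ℝ} (hp : p ∈ Ioo (0 : ℝ) 1) (a : ℝ) {x : ℝ} (hx : 0 ≤ x) :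
    ∃ (Φ : ℂ → ℂ) (L₁ L₂ : ℂ), (∀ u, HasDerivAt Φ (logIntegrand p a x u) u) ∧
      contourIntegral p a x = L₁ - L₂ ∧
      (∀ u : ℝ → ℂ, Tendsto (fun w => (u w).re) atTop atTop →
        (∀ᶠ w in atTop, (u w).im ∈ Icc (contourAngle p) Real.pi) →
        Tendsto (fun w => Φ (u w)) atTop (𝓝 L₁)) ∧
      (∀ u : ℝ → ℂ, Tendsto (fun w => (u w).re) atTop atTop →
        (∀ᶠ w in atTop, (u w).im ∈ Icc (-Real.pi) (-contourAngle p)) →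
        Tendsto (fun w => Φ (u w)) atTop (𝓝 L₂)) := by
  obtain ⟨Φ, hΦ⟩ := (differentiable_logIntegrand p a x).isExactOn_univ
  replace hΦ : ∀ u, HasDerivAt Φ (logIntegrand p a x u) u := fun u => hΦ u (mem_univ u)
  have hd : ∀ y : ℝ, HasDerivAt (fun y => Φ (contour p y))
      (logIntegrand p a x (contour p y) * contourDeriv p y) y := fun y =>
    HasDerivAt.comp_of_eq y (hΦ _) (hasDerivAt_contour p y) rfl
  have hint := by simpa using integrable_shifted_contour hp a hx 0
  have hκ : 0 < -Real.cos (contourAngle p) := neg_pos.2 (cos_contourAngle_neg hp)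
  have h1 := tendsto_limUnder_of_hasDerivAt_of_integrableOn_Ioi (a := 0) (fun y _ => hd y)
    hint.integrableOn
  have h2 := tendsto_limUnder_of_hasDerivAt_of_integrableOn_Iic (a := 0) (fun y _ => hd y)
    hint.integrableOn
  have hsq : ∀ v : ℝ, 0 ≤ v → contour p (√v) = v + (opening p * Real.arctan √v : ℝ) * I := by
    intro v hv
    rw [contour, Real.sq_sqrt hv]
  have hsq' : ∀ v : ℝ, 0 ≤ v → contour p (-√v) = v + (-(opening p * Real.arctan √v) : ℝ) * I := by
    intro v hv
    rw [contour, neg_sq, Real.sq_sqrt hv, Real.arctan_neg, mul_neg]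
  have him := Real.tendsto_sqrt_atTop.eventually (eventually_contour_im_mem hp)
  refine ⟨Φ, _, _, hΦ, integral_of_hasDerivAt_of_tendsto hd hint h2 h1, fun u hu hu' => ?_,
    fun u hu hu' => ?_⟩
  · refine tendsto_primitive_of_re_atTop hp.2 hx hκ (fun θ hθ => cos_le_of_mem_upper hp hθ) hΦ him
      ((h1.comp Real.tendsto_sqrt_atTop).congr' ?_) hu hu'
    filter_upwards [eventually_ge_atTop 0] with v hv
    rw [Function.comp_apply, hsq v hv]
  · refine tendsto_primitive_of_re_atTop (h := fun v => -(opening p * Real.arctan √v)) hp.2 hx hκ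
      (fun θ hθ => cos_le_of_mem_lower hp hθ) hΦ ?_
      ((h2.comp (tendsto_neg_atTop_atBot.comp Real.tendsto_sqrt_atTop)).congr' ?_) hu hu'
    · filter_upwards [him] with v hv
      exact ⟨by linarith [hv.2], by linarith [hv.1]⟩
    · filter_upwards [eventually_ge_atTop 0] with v hv
      rw [Function.comp_apply, Function.comp_apply, hsq' v hv]

/-- The contour may be shifted horizontally. -/
theorem contourIntegral_eq_shifted {p : ℝ} (hp : p ∈ Ioo (0 : ℝ) 1) (a : ℝ) {x : ℝ} (hx : 0 ≤ x)
    (l : ℝ) : contourIntegral p a x =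
      ∫ y : ℝ, logIntegrand p a x (contour p y + l) * contourDeriv p y := by
  obtain ⟨Φ, L₁, L₂, hΦ, hJ, hup, hlow⟩ := exists_primitive_with_limits hp a hx
  have hd : ∀ y : ℝ, HasDerivAt (fun y => Φ (contour p y + l))
      (logIntegrand p a x (contour p y + l) * contourDeriv p y) y := fun y =>
    HasDerivAt.comp_of_eq y (hΦ _) ((hasDerivAt_contour p y).add_const (l : ℂ)) rfl
  have hsq : Tendsto (fun y : ℝ => y ^ 2 + l) atTop atTop :=
    tendsto_atTop_add_const_right _ l (tendsto_pow_atTop two_ne_zero)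
  have htop := hup (fun y => contour p y + l) (hsq.congr fun y => by simp) (by
    filter_upwards [eventually_contour_im_mem hp] with y hy
    simpa using hy)
  have hbot := hlow (fun y => contour p (-y) + l) (hsq.congr fun y => by simp) (by
    filter_upwards [eventually_contour_im_mem hp] with y hy
    simpa [and_comm] using hy)
  have hbot' := hbot.comp tendsto_neg_atBot_atTop
  simp only [Function.comp_def, neg_neg] at hbot'
  rw [hJ, integral_of_hasDerivAt_of_tendsto hd (integrable_shifted_contour hp a hx l) hbot' htop]

/-! ### The Hankel contour -/

/-- Since `s ^ (p - 1) ds = s ^ p ds / s` and `ds / s = du`, the substitution `u = log s` turns the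
multivalued integrand into an entire one. -/
theorem densityIntegrand_neg {p x : ℝ} {s : ℂ} (hs : s ≠ 0) :
    densityIntegrand p x (-s) = logIntegrand p p x (Complex.log s) * s⁻¹ := by
  have h : s⁻¹ = Complex.exp (-Complex.log s) := by rw [Complex.exp_neg, Complex.exp_log hs]
  rw [densityIntegrand, logIntegrand, h, neg_neg, Complex.cpow_def_of_ne_zero hs,
    Complex.cpow_def_of_ne_zero hs, ← Complex.exp_sub, ← Complex.exp_add, Complex.exp_log hs]
  congr 1
  rw [mul_comm (Complex.log s) p]
  ring

theorem hasDerivAt_comp_log {p x : ℝ} {Φ : ℂ → ℂ} (hΦ : ∀ u, HasDerivAt Φ (logIntegrand p p x u) u)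
    {c : ℝ → ℂ} {c' : ℂ} {w : ℝ} (hc : HasDerivAt c c' w) (hs : c w ∈ Complex.slitPlane) :
    HasDerivAt (fun w => Φ (Complex.log (c w))) (densityIntegrand p x (-c w) * c') w := by
  have h := HasDerivAt.comp_of_eq w (hΦ _) (hc.clog_real hs) rfl
  rw [densityIntegrand_neg (Complex.slitPlane_ne_zero hs), mul_assoc, inv_mul_eq_div]
  exact h

theorem continuousOn_densityIntegrand_neg (p x : ℝ) :
    ContinuousOn (fun s => densityIntegrand p x (-s)) Complex.slitPlane := by
  have h : ContinuousOn (fun s => logIntegrand p p x (Complex.log s) * s⁻¹) Complex.slitPlane :=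
    ((continuous_logIntegrand p p x).comp_continuousOn
      (continuousOn_id.clog fun s hs => hs)).mul
      (continuousOn_id.inv₀ fun s hs => Complex.slitPlane_ne_zero hs)
  exact h.congr fun s hs => densityIntegrand_neg (Complex.slitPlane_ne_zero hs)

theorem norm_densityIntegrand_neg_le {p x : ℝ} (hp : p ∈ Ioo (0 : ℝ) 1) (hx : 0 ≤ x) {s : ℂ}
    (hs : s ≠ 0) {δ : ℝ} (hδ : 0 < δ) (hδs : δ ≤ ‖s‖) :
    ‖densityIntegrand p x (-s)‖ ≤ Real.exp (s.re + x * ‖s‖ ^ p) * δ ^ (p - 1) := by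
  have hns : 0 < ‖s‖ := norm_pos_iff.2 hs
  rw [densityIntegrand, neg_neg, norm_div, Complex.norm_exp]
  have h1 : ‖s ^ ((1 : ℂ) - p)‖ = ‖s‖ ^ (1 - p) := by
    rw [← Complex.ofReal_one, ← Complex.ofReal_sub,
      Complex.norm_cpow_real]
  have h2 : -(‖s‖ ^ p) ≤ (s ^ (p : ℂ)).re := by
    rw [← Complex.norm_cpow_real]
    exact (abs_le.1 (Complex.abs_re_le_norm _)).1
  rw [h1, div_eq_mul_inv, ← Real.rpow_neg hns.le, neg_sub]
  gcongr ?_ * ?_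
  · rw [Real.exp_le_exp, Complex.sub_re, Complex.re_ofReal_mul]
    nlinarith
  · exact Real.rpow_le_rpow_of_nonpos hδ hδs (by linarith [hp.2])

theorem norm_neg_add_mul_I_le {w σ : ℝ} (hw : 0 ≤ w) : ‖(-w + σ * I : ℂ)‖ ≤ w + |σ| := by
  refine (norm_add_le _ _).trans ?_
  rw [norm_neg, norm_mul, Complex.norm_I, mul_one, Complex.norm_real, Complex.norm_real,
    Real.norm_of_nonneg hw, Real.norm_eq_abs]

theorem neg_add_mul_I_mem_slitPlane {w σ : ℝ} (hσ : σ ≠ 0) :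
    (-w + σ * I : ℂ) ∈ Complex.slitPlane := by
  right
  simpa using hσ

theorem tendsto_ray_exponent {p : ℝ} (hp : p ∈ Ioo (0 : ℝ) 1) (x δ : ℝ) :
    Tendsto (fun w : ℝ => -w / 2 + x * (w + δ) ^ p) atTop atBot := by
  have h1 : Tendsto (fun w : ℝ => -(1 / 2) + x * w ^ (-(1 - p))) atTop (𝓝 (-(1 / 2) + x * 0)) :=
    ((tendsto_rpow_neg_atTop (sub_pos.2 hp.2)).const_mul x).const_add _
  have h2 := tendsto_id.atTop_mul_neg (by norm_num) h1
  have h3 : Tendsto (fun w : ℝ => w + δ) atTop atTop := tendsto_atTop_add_const_right _ _ tendsto_id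
  have h4 := tendsto_atBot_add_const_right _ (δ / 2) (h2.comp h3)
  refine h4.congr' ?_
  filter_upwards [h3.eventually_gt_atTop 0] with w hw
  have : (w + δ) * (w + δ) ^ (-(1 - p)) = (w + δ) ^ p := by
    rw [← Real.rpow_one_add' hw.le (by linarith [hp.1])]
    congr 1
    ring
  simp only [Function.comp_apply, id_eq]
  linear_combination x * this

theorem integrableOn_ray {p x σ : ℝ} (hp : p ∈ Ioo (0 : ℝ) 1) (hx : 0 ≤ x) (hσ : σ ≠ 0) :
    IntegrableOn (fun w : ℝ => densityIntegrand p x (-(-w + σ * I))) (Ioi 0) := by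
  have hcont : Continuous fun w : ℝ => densityIntegrand p x (-(-w + σ * I)) :=
    (continuousOn_densityIntegrand_neg p x).comp_continuous (f := fun w : ℝ => (-w + σ * I : ℂ))
      (by fun_prop) fun w => neg_add_mul_I_mem_slitPlane hσ
  rw [IntegrableOn, ← integrable_norm_iff hcont.aestronglyMeasurable]
  -- Half of the decay `exp (-w)` absorbs `x * (w + |σ|) ^ p`; the other half remains as the
  -- dominating function.
  refine integrable_of_isBigO_exp_neg (b := 1 / 2) (by norm_num) hcont.norm.continuousOn
    (Asymptotics.IsBigO.of_bound (|σ| ^ (p - 1)) ?_)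
  filter_upwards [(tendsto_ray_exponent hp x |σ|).eventually_le_atBot 0, eventually_ge_atTop 0]
    with w hw hw0
  rw [norm_norm]
  have hle : |σ| ≤ ‖(-w + σ * I : ℂ)‖ := by
    simpa using Complex.abs_im_le_norm (-w + σ * I : ℂ)
  refine (norm_densityIntegrand_neg_le hp hx (Complex.slitPlane_ne_zero
    (neg_add_mul_I_mem_slitPlane hσ)) (abs_pos.2 hσ) hle).trans ?_
  rw [mul_comm, Real.norm_of_nonneg (Real.exp_pos _).le]
  gcongr
  have h1 : ‖(-w + σ * I : ℂ)‖ ^ p ≤ (w + |σ|) ^ p :=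
    Real.rpow_le_rpow (norm_nonneg _) (norm_neg_add_mul_I_le hw0) hp.1.le
  have h2 := mul_le_mul_of_nonneg_left h1 hx
  simp only [Complex.add_re, Complex.neg_re, Complex.ofReal_re, Complex.re_ofReal_mul, Complex.I_re,
    mul_zero, add_zero]
  linarith

theorem tendsto_log_ray_re {σ : ℝ} :
    Tendsto (fun w : ℝ => (Complex.log (-w + σ * I)).re) atTop atTop := by
  simp only [Complex.log_re]
  refine Real.tendsto_log_atTop.comp (tendsto_atTop_mono' _ ?_ tendsto_id)
  filter_upwards with w
  refine (le_abs_self w).trans ?_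
  simpa using Complex.abs_re_le_norm (-w + σ * I : ℂ)

theorem tendsto_log_ray_im {δ : ℝ} (hδ : 0 < δ) :
    Tendsto (fun w : ℝ => (Complex.log (-w + δ * I)).im) atTop (𝓝 Real.pi) := by
  have h : Tendsto (fun w : ℝ => Real.pi - Real.arctan (δ / w)) atTop (𝓝 (Real.pi - 0)) := by
    refine tendsto_const_nhds.sub ?_
    have : Tendsto (fun w : ℝ => δ / w) atTop (𝓝 0) := tendsto_const_nhds.div_atTop tendsto_id
    simpa [Function.comp_def] using (Real.continuous_arctan.tendsto 0).comp this
  rw [sub_zero] at h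
  refine h.congr' ?_
  filter_upwards [eventually_gt_atTop 0] with w hw
  have h1 : (-w + δ * I : ℂ) = -(w - δ * I) := by ring
  have h2 : (w - δ * I : ℂ).im < 0 := by simpa using hδ
  rw [Complex.log_im, h1, Complex.arg_neg_eq_arg_add_pi_of_im_neg h2,
    Complex.arg_of_re_nonneg (by simpa using hw.le), Real.arctan_eq_arcsin]
  have h3 : ‖(w - δ * I : ℂ)‖ = w * √(1 + (δ / w) ^ 2) := by
    rw [Complex.norm_def, Complex.normSq_apply, ← Real.sqrt_sq hw.le,
      ← Real.sqrt_mul (by positivity), Real.sqrt_sq hw.le]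
    congr 1
    simp
    field_simp
  rw [h3]
  have h4 : (w - δ * I : ℂ).im / (w * √(1 + (δ / w) ^ 2)) = -(δ / w / √(1 + (δ / w) ^ 2)) := by
    simp
    field_simp
  rw [h4, Real.arcsin_neg]
  ring

theorem conj_neg_add_mul_I (w δ : ℝ) :
    (starRingEnd ℂ) (-w + δ * I) = -w + (-δ : ℝ) * I := by
  simp

theorem log_ray_neg_im {w δ : ℝ} (hδ : 0 < δ) :
    (Complex.log (-w + (-δ : ℝ) * I)).im = -(Complex.log (-w + δ * I)).im := by
  rw [← conj_neg_add_mul_I, Complex.log_conj, Complex.conj_im]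
  intro h
  have := Complex.mem_slitPlane_iff_arg.1 (neg_add_mul_I_mem_slitPlane (w := w) hδ.ne')
  exact this.1 h

theorem neg_circleMap_mem_slitPlane {δ : ℝ} (hδ : 0 < δ) {φ : ℝ}
    (hφ : φ ∈ Icc (Real.pi / 2) (3 * Real.pi / 2)) : -circleMap 0 δ φ ∈ Complex.slitPlane := by
  have hre : (circleMap 0 δ φ).re = δ * Real.cos φ := by simp [circleMap, Complex.exp_ofReal_mul_I_re]
  have him : (circleMap 0 δ φ).im = δ * Real.sin φ := by simp [circleMap, Complex.exp_ofReal_mul_I_im]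
  rw [Complex.mem_slitPlane_iff, Complex.neg_re, Complex.neg_im, hre, him]
  by_cases h : Real.sin φ = 0
  · left
    have hc : Real.cos φ ≤ 0 := by
      apply Real.cos_nonpos_of_pi_div_two_le_of_le hφ.1
      linarith [hφ.2]
    have : Real.cos φ ≠ 0 := by
      intro hc0
      have := Real.sin_sq_add_cos_sq φ
      rw [h, hc0] at this
      norm_num at this
    nlinarith [lt_of_le_of_ne hc this]
  · right
    exact neg_ne_zero.2 (mul_ne_zero hδ.ne' h)

/-- Along all three pieces `-t` stays in the slit plane, so `-Φ (log (-t))` is a primitive there.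
Its values at the two junctions cancel, and the ends contribute the same limits `L₁` and `L₂` as the
smooth contour, whence the independence of `δ`. -/
theorem hankelIntegrable_and_hankelIntegral_eq {p : ℝ} (hp : p ∈ Ioo (0 : ℝ) 1) {x : ℝ}
    (hx : 0 ≤ x) {δ : ℝ} (hδ : 0 < δ) :
    HankelIntegrable δ (densityIntegrand p x) ∧
      hankelIntegral δ (densityIntegrand p x) = contourIntegral p p x := by
  obtain ⟨Φ, L₁, L₂, hΦ, hJ, hup, hlow⟩ := exists_primitive_with_limits hp p hx
  have hπ : Real.pi / 2 ≤ 3 * Real.pi / 2 := by linarith [Real.pi_pos]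
  have e1 : ∀ w : ℝ, (w - δ * I : ℂ) = -(-w + δ * I) := fun w => by ring
  have e2 : ∀ w : ℝ, (w + δ * I : ℂ) = -(-w + (-δ : ℝ) * I) := fun w => by push_cast; ring
  have i1 : IntegrableOn (fun w : ℝ => densityIntegrand p x (w - δ * I)) (Ioi 0) := by
    simp only [e1]
    exact integrableOn_ray hp hx hδ.ne'
  have i3 : IntegrableOn (fun w : ℝ => densityIntegrand p x (w + δ * I)) (Ioi 0) := by
    simp only [e2]
    exact integrableOn_ray hp hx (neg_ne_zero.2 hδ.ne')
  have i2 : IntervalIntegrable (fun φ : ℝ => densityIntegrand p x (circleMap 0 δ φ) *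
      deriv (circleMap 0 δ) φ) volume (3 * Real.pi / 2) (Real.pi / 2) := by
    refine ContinuousOn.intervalIntegrable ?_
    rw [uIcc_of_ge hπ]
    refine ContinuousOn.mul ?_ ?_
    · have := (continuousOn_densityIntegrand_neg p x).comp
        (f := fun φ : ℝ => -circleMap 0 δ φ) (by fun_prop)
        (fun φ hφ => neg_circleMap_mem_slitPlane hδ hφ)
      simpa [Function.comp_def] using this
    · have : deriv (circleMap 0 δ) = fun φ => circleMap 0 δ φ * I :=
        funext fun φ => deriv_circleMap 0 δ φ
      rw [this]
      fun_prop
  refine ⟨⟨i1, i2, i3⟩, ?_⟩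
  have hray : ∀ σ w : ℝ, HasDerivAt (fun w : ℝ => (-w + σ * I : ℂ)) (-1) w := fun σ w => by
    simpa using (Complex.ofRealCLM.hasDerivAt (x := w)).neg.add_const (σ * I)
  have him := (tendsto_log_ray_im hδ).eventually_const_lt (contourAngle_lt_pi hp)
  have v1 : ∫ w : ℝ in Ioi 0, densityIntegrand p x (w - δ * I) =
      -L₁ - -Φ (Complex.log (-(0 : ℝ) + δ * I)) := by
    refine integral_Ioi_of_hasDerivAt_of_tendsto' (fun w _ => ?_) i1
      (hup (fun w => Complex.log (-w + δ * I)) tendsto_log_ray_re ?_).neg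
    · have := (hasDerivAt_comp_log hΦ (hray δ w) (neg_add_mul_I_mem_slitPlane hδ.ne')).fun_neg
      rw [e1]
      simpa using this
    · filter_upwards [him] with w hw
      exact ⟨hw.le, (Complex.log_im _) ▸ Complex.arg_le_pi _⟩
  have v3 : ∫ w : ℝ in Ioi 0, densityIntegrand p x (w + δ * I) =
      -L₂ - -Φ (Complex.log (-(0 : ℝ) + (-δ : ℝ) * I)) := by
    refine integral_Ioi_of_hasDerivAt_of_tendsto' (fun w _ => ?_) i3
      (hlow (fun w => Complex.log (-w + (-δ : ℝ) * I)) tendsto_log_ray_re ?_).neg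
    · have := (hasDerivAt_comp_log hΦ (hray (-δ) w)
        (neg_add_mul_I_mem_slitPlane (neg_ne_zero.2 hδ.ne'))).fun_neg
      rw [e2]
      simpa using this
    · filter_upwards [him] with w hw
      rw [log_ray_neg_im hδ]
      exact ⟨neg_le_neg ((Complex.log_im _) ▸ Complex.arg_le_pi _), neg_le_neg hw.le⟩
  have v2 : ∫ φ : ℝ in (3 * Real.pi / 2)..(Real.pi / 2), densityIntegrand p x (circleMap 0 δ φ) *
      deriv (circleMap 0 δ) φ = -Φ (Complex.log (-circleMap 0 δ (Real.pi / 2))) -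
        -Φ (Complex.log (-circleMap 0 δ (3 * Real.pi / 2))) := by
    refine intervalIntegral.integral_eq_sub_of_hasDerivAt
      (f := fun φ : ℝ => -Φ (Complex.log (-circleMap 0 δ φ))) (fun φ hφ => ?_) i2
    rw [uIcc_of_ge hπ] at hφ
    have := (hasDerivAt_comp_log hΦ (hasDerivAt_circleMap 0 δ φ).fun_neg
      (neg_circleMap_mem_slitPlane hδ hφ)).fun_neg
    rw [deriv_circleMap]
    simpa using this
  have c1 : -circleMap 0 δ (Real.pi / 2) = -(0 : ℝ) + (-δ : ℝ) * I := by
    simp [circleMap, Complex.exp_mul_I]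
  have c2 : -circleMap 0 δ (3 * Real.pi / 2) = -(0 : ℝ) + δ * I := by
    have : (3 * Real.pi / 2 : ℂ) = Real.pi / 2 + Real.pi := by ring
    simp [circleMap, this, Complex.exp_mul_I, Complex.cos_add, Complex.sin_add]
  rw [hankelIntegral, v1, v2, v3, hJ, c1, c2]
  ring

/-! ### Hankel's formula for the reciprocal of the Gamma function -/

theorem logIntegrand_line (p z v σ : ℝ) :
    logIntegrand p (-z) 0 (v + σ * I) =
      Complex.exp (Complex.exp (v + σ * I)) * Real.exp (-z * v) * Complex.exp (-z * σ * I) := by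
  rw [logIntegrand, Complex.ofReal_exp, ← Complex.exp_add, ← Complex.exp_add]
  congr 1
  push_cast
  ring

theorem hasDerivAt_primitive_line {g Φ : ℂ → ℂ} (hΦ : ∀ u, HasDerivAt Φ (g u) u) (σ v : ℝ) :
    HasDerivAt (fun v : ℝ => Φ (v + σ * I)) (g (v + σ * I)) v := by
  have h : HasDerivAt (fun v : ℝ => (v + σ * I : ℂ)) 1 v := by
    simpa using (Complex.ofRealCLM.hasDerivAt (x := v)).add_const (σ * I)
  exact (HasDerivAt.comp_of_eq v (hΦ _) h rfl).congr_deriv (mul_one _)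

theorem exp_add_pi_mul_I (v : ℝ) : Complex.exp (v + Real.pi * I) = -Real.exp v := by
  rw [Complex.exp_add, Complex.exp_pi_mul_I, Complex.ofReal_exp]
  ring

theorem exp_add_neg_pi_mul_I (v : ℝ) : Complex.exp (v + (-Real.pi : ℝ) * I) = -Real.exp v := by
  rw [Complex.exp_add, Complex.ofReal_neg, neg_mul, Complex.exp_neg, Complex.exp_pi_mul_I,
    Complex.ofReal_exp]
  norm_num

/-- On both lines `exp u = -exp v`, so the two values differ only through the phases `exp (∓ i π
z)`. What remains is the integrand of Euler's integral for `Γ(-z)`. -/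
theorem sub_logIntegrand_lines (p z v : ℝ) :
    logIntegrand p (-z) 0 (v + Real.pi * I) - logIntegrand p (-z) 0 (v + (-Real.pi : ℝ) * I) =
      -(2 * I * Real.sin (Real.pi * z)) * (Real.exp (-Real.exp v) * Real.exp (-z * v) : ℝ) := by
  rw [logIntegrand_line, logIntegrand_line, exp_add_pi_mul_I, exp_add_neg_pi_mul_I]
  have h1 : Complex.exp (-z * Real.pi * I) = Complex.cos (Real.pi * z) - Complex.sin (Real.pi * z) * I := by
    rw [show (-z * Real.pi * I : ℂ) = (-(Real.pi * z : ℂ)) * I by ring, Complex.exp_mul_I,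
      Complex.cos_neg, Complex.sin_neg]
    ring
  have h2 : Complex.exp (-z * (-Real.pi : ℝ) * I) =
      Complex.cos (Real.pi * z) + Complex.sin (Real.pi * z) * I := by
    rw [show (-z * (-Real.pi : ℝ) * I : ℂ) = (Real.pi * z : ℂ) * I by push_cast; ring,
      Complex.exp_mul_I]
  rw [h1, h2]
  push_cast
  ring

/-- The substitution `t = e ^ v` in Euler's integral. -/
theorem integrable_and_integral_exp_neg_exp {s : ℝ} (hs : 0 < s) :
    Integrable (fun v : ℝ => Real.exp (-Real.exp v) * Real.exp (s * v)) ∧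
      ∫ v : ℝ, Real.exp (-Real.exp v) * Real.exp (s * v) = Real.Gamma s := by
  have himg : Real.exp '' univ = Ioi 0 := by rw [image_univ, Real.range_exp]
  have hd : ∀ v ∈ (univ : Set ℝ), HasDerivWithinAt Real.exp (Real.exp v) univ v :=
    fun v _ => (Real.hasDerivAt_exp v).hasDerivWithinAt
  have heq : ∀ v : ℝ, |Real.exp v| • (Real.exp (-Real.exp v) * Real.exp v ^ (s - 1)) =
      Real.exp (-Real.exp v) * Real.exp (s * v) := by
    intro v
    rw [abs_of_pos (Real.exp_pos v), smul_eq_mul, ← Real.exp_mul, mul_left_comm, ← Real.exp_add]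
    congr 2
    ring
  constructor
  · have h := (integrableOn_image_iff_integrableOn_abs_deriv_smul MeasurableSet.univ hd
      Real.exp_injective.injOn fun t => Real.exp (-t) * t ^ (s - 1)).1
      (by rw [himg]; exact Real.GammaIntegral_convergent hs)
    rw [integrableOn_univ] at h
    exact h.congr (ae_of_all _ heq)
  · have h := integral_image_eq_integral_abs_deriv_smul MeasurableSet.univ hd
      Real.exp_injective.injOn fun t => Real.exp (-t) * t ^ (s - 1)
    rw [himg, setIntegral_univ, ← Real.Gamma_eq_integral hs] at h
    rw [h]
    exact integral_congr_ae (ae_of_all _ fun v => (heq v).symm)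

/-- A bound for the increment of a primitive along a vertical segment between `v ± i π`. -/
theorem norm_sub_lines_le {g Φ : ℂ → ℂ} (hΦ : ∀ u, HasDerivAt Φ (g u) u) {v C : ℝ}
    (hC : ∀ u : ℂ, u.re = v → ‖g u‖ ≤ C) :
    ‖Φ (v + Real.pi * I) - Φ (v + (-Real.pi : ℝ) * I)‖ ≤ C * (2 * Real.pi) := by
  have hconv : Convex ℝ (Complex.reLm ⁻¹' {v}) :=
    (convex_singleton v).linear_preimage Complex.reLm
  have h := hconv.norm_image_sub_le_of_norm_hasDerivWithin_le (f := Φ) (f' := g) (C := C)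
    (x := v + (-Real.pi : ℝ) * I) (y := v + Real.pi * I)
    (fun z _ => (hΦ z).hasDerivWithinAt) (fun z hz => hC z (by simpa using hz)) (by simp)
    (by simp)
  convert h using 2
  rw [show (v + Real.pi * I - (v + (-Real.pi : ℝ) * I) : ℂ) = (2 * Real.pi : ℝ) * I by
    push_cast; ring, norm_mul, Complex.norm_I, mul_one, Complex.norm_real,
    Real.norm_of_nonneg (by positivity)]

/-- The lines `Im u = ±π` lie in the closed strips admitted by `exists_primitive_with_limits`, so
they compute the same difference of limits. They correspond to the two sides of the cut of `log`. -/
theorem exists_primitive_lines {p : ℝ} (hp : p ∈ Ioo (0 : ℝ) 1) (z : ℝ) :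
    ∃ Φ : ℂ → ℂ, (∀ u, HasDerivAt Φ (logIntegrand p (-z) 0 u) u) ∧
      Tendsto (fun v : ℝ => Φ (v + Real.pi * I) - Φ (v + (-Real.pi : ℝ) * I)) atTop
        (𝓝 (contourIntegral p (-z) 0)) := by
  obtain ⟨Φ, L₁, L₂, hΦ, hJ, hup, hlow⟩ := exists_primitive_with_limits hp (-z) le_rfl
  have hle := (contourAngle_lt_pi hp).le
  refine ⟨Φ, hΦ, hJ ▸ (hup _ ?_ ?_).sub (hlow _ ?_ ?_)⟩
  · exact tendsto_id.congr fun w => by simp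
  · exact Eventually.of_forall fun _ => by simpa using hle
  · exact tendsto_id.congr fun w => by simp
  · exact Eventually.of_forall fun _ => by simpa using hle

theorem norm_logIntegrand_neg_le (p z : ℝ) (u : ℂ) :
    ‖logIntegrand p (-z) 0 u‖ ≤ Real.exp (Real.exp u.re - z * u.re) := by
  rw [norm_logIntegrand]
  have := mul_le_mul_of_nonneg_left (Real.cos_le_one u.im) (Real.exp_pos u.re).le
  rw [Real.exp_le_exp]
  linarith

/-- The difference of the primitive on the lines `Im u = ±π` tends to `0` on the left because `-z >
0`. Integrating its derivative therefore gives `-2 i sin (π z) Γ(-z)`, which the reflection formula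
converts. -/
theorem contourIntegral_of_neg {p : ℝ} (hp : p ∈ Ioo (0 : ℝ) 1) {z : ℝ} (hz : z ∈ Ioo (-1 : ℝ) 0) :
    contourIntegral p (-z) 0 = 2 * Real.pi * I / Real.Gamma (1 + z) := by
  obtain ⟨Φ, hΦ, hlim⟩ := exists_primitive_lines hp z
  obtain ⟨hint, hval⟩ := integrable_and_integral_exp_neg_exp (s := -z) (by linarith [hz.2])
  have hbot : Tendsto (fun v : ℝ => Φ (v + Real.pi * I) - Φ (v + (-Real.pi : ℝ) * I)) atBot
      (𝓝 0) := by
    have hB : Tendsto (fun v : ℝ => Real.exp (Real.exp v - z * v) * (2 * Real.pi)) atBot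
        (𝓝 (0 * (2 * Real.pi))) := by
      refine (Real.tendsto_exp_atBot.comp ?_).mul_const _
      have h1 : Tendsto (fun v : ℝ => -z * v) atBot atBot :=
        tendsto_id.const_mul_atBot (by linarith [hz.2])
      refine (Real.tendsto_exp_atBot.add_atBot h1).congr fun v => ?_
      ring
    rw [zero_mul] at hB
    exact squeeze_zero_norm (fun v => norm_sub_lines_le hΦ fun u hu => by
      simpa [hu] using norm_logIntegrand_neg_le p z u) hB
  have h := integral_of_hasDerivAt_of_tendsto (fun v =>
    ((hasDerivAt_primitive_line hΦ Real.pi v).sub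
      (hasDerivAt_primitive_line hΦ (-Real.pi) v)).congr_deriv (sub_logIntegrand_lines p z v))
    (hint.ofReal.const_mul _) hbot hlim
  rw [sub_zero, integral_const_mul, integral_complex_ofReal, hval] at h
  rw [← h]
  have hrefl := Real.Gamma_mul_Gamma_one_sub (-z)
  rw [sub_neg_eq_add, mul_neg, Real.sin_neg, div_neg] at hrefl
  have hsin : Real.sin (Real.pi * z) ≠ 0 := by
    have := Real.sin_pos_of_pos_of_lt_pi (x := Real.pi * -z)
      (by nlinarith [Real.pi_pos, hz.2]) (by nlinarith [Real.pi_pos, hz.1])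
    rw [mul_neg, Real.sin_neg] at this
    linarith
  have hG : Real.Gamma (1 + z) ≠ 0 := (Real.Gamma_pos_of_pos (by linarith [hz.1])).ne'
  have h3 : Real.sin (Real.pi * z) * Real.Gamma (-z) * Real.Gamma (1 + z) = -Real.pi := by
    rw [mul_assoc, hrefl]
    field_simp
  have h3' : (Real.sin (Real.pi * z) : ℂ) * Real.Gamma (-z) * Real.Gamma (1 + z) = -Real.pi := by
    exact_mod_cast h3
  have hG' : (Real.Gamma (1 + z) : ℂ) ≠ 0 := by exact_mod_cast hG
  rw [eq_div_iff hG']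
  linear_combination (-2 * I) * h3'

/-- Euler's integral diverges here, but the sine factor vanishes, so the difference between the two
lines is constant. Its value is read off at `-∞`, where the integrand tends to `1` on a segment of
length `2 π`. -/
theorem contourIntegral_zero {p : ℝ} (hp : p ∈ Ioo (0 : ℝ) 1) :
    contourIntegral p 0 0 = 2 * Real.pi * I := by
  obtain ⟨Φ, hΦ, hlim⟩ := exists_primitive_lines hp 0
  rw [neg_zero] at hlim
  have hd : ∀ v : ℝ, HasDerivAt
      (fun v : ℝ => Φ (v + Real.pi * I) - Φ (v + (-Real.pi : ℝ) * I)) 0 v := fun v =>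
    ((hasDerivAt_primitive_line hΦ Real.pi v).sub
      (hasDerivAt_primitive_line hΦ (-Real.pi) v)).congr_deriv (by
        rw [sub_logIntegrand_lines]; simp)
  have hconst : ∀ v : ℝ, Φ (v + Real.pi * I) - Φ (v + (-Real.pi : ℝ) * I) =
      contourIntegral p 0 0 := by
    intro v
    refine tendsto_nhds_unique (tendsto_const_nhds (f := (atTop : Filter ℝ))) (hlim.congr fun w => ?_)
    exact is_const_of_deriv_eq_zero (fun v => (hd v).differentiableAt) (fun v => (hd v).deriv) w v
  have hbot : Tendsto (fun v : ℝ => contourIntegral p 0 0 - 2 * Real.pi * I) atBot (𝓝 0) := by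
    have hB : Tendsto (fun v : ℝ => 2 * Real.exp v * (2 * Real.pi)) atBot
        (𝓝 (2 * 0 * (2 * Real.pi))) := (Real.tendsto_exp_atBot.const_mul 2).mul_const _
    rw [mul_zero, zero_mul] at hB
    refine squeeze_zero_norm' ?_ hB
    filter_upwards [eventually_le_atBot 0] with v hv
    -- Subtracting the identity isolates the main term `2 π i`; the derivative that remains is `exp
    -- (exp u) - 1`.
    have hsub : ∀ u, HasDerivAt (fun u => Φ u - u) (logIntegrand p (-0) 0 u - 1) u :=
      fun u => (hΦ u).sub (hasDerivAt_id u)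
    have h := norm_sub_lines_le hsub (v := v) (C := 2 * Real.exp v) fun u hu => by
      have hn : ‖Complex.exp u‖ = Real.exp v := by rw [Complex.norm_exp, hu]
      have h1 : ‖Complex.exp u‖ ≤ 1 := by rw [hn]; exact Real.exp_le_one_iff.2 hv
      have h2 := Complex.norm_exp_sub_one_le h1
      rw [hn] at h2
      simpa [logIntegrand] using h2
    refine le_trans (le_of_eq ?_) h
    rw [← hconst v]
    congr 1
    push_cast
    ring
  have := tendsto_nhds_unique hbot tendsto_const_nhds
  exact (sub_eq_zero.1 this.symm)

/-- The functional equation of Gamma in contour form: the derivative of `logIntegrand p (-(z + 1))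
0` integrates to zero, because this function vanishes at both ends of the contour. -/
theorem contourIntegral_recurrence {p : ℝ} (hp : p ∈ Ioo (0 : ℝ) 1) (z : ℝ) :
    contourIntegral p (-z) 0 = (z + 1) * contourIntegral p (-(z + 1)) 0 := by
  have hE : ∀ u : ℂ, HasDerivAt (logIntegrand p (-(z + 1)) 0)
      (logIntegrand p (-z) 0 u - (z + 1) * logIntegrand p (-(z + 1)) 0 u) u := by
    intro u
    have h : HasDerivAt (fun u : ℂ => Complex.exp (Complex.exp u + ((-(z + 1) : ℝ) : ℂ) * u))
        (Complex.exp (Complex.exp u + ((-(z + 1) : ℝ) : ℂ) * u) *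
          (Complex.exp u + ((-(z + 1) : ℝ) : ℂ) * 1)) u :=
      ((Complex.hasDerivAt_exp u).add ((hasDerivAt_id u).const_mul _)).cexp
    have heq : logIntegrand p (-(z + 1)) 0 =
        fun u : ℂ => Complex.exp (Complex.exp u + ((-(z + 1) : ℝ) : ℂ) * u) := by
      funext u
      simp [logIntegrand]
    have heq' : logIntegrand p (-z) 0 u =
        Complex.exp (Complex.exp u + ((-(z + 1) : ℝ) : ℂ) * u) * Complex.exp u := by
      rw [logIntegrand, ← Complex.exp_add]
      congr 1
      push_cast
      ring
    rw [heq']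
    simp only [heq]
    refine h.congr_deriv ?_
    push_cast
    ring
  have i0 := integrable_contour_zero hp (-z)
  have i1 := (integrable_contour_zero hp (-(z + 1))).const_mul ((z : ℂ) + 1)
  have hd : ∀ y : ℝ, HasDerivAt (fun y => logIntegrand p (-(z + 1)) 0 (contour p y))
      (logIntegrand p (-z) 0 (contour p y) * contourDeriv p y -
        (z + 1) * (logIntegrand p (-(z + 1)) 0 (contour p y) * contourDeriv p y)) y := fun y =>
    (HasDerivAt.comp_of_eq y (hE _) (hasDerivAt_contour p y) rfl).congr_deriv (by ring)
  have hlim := tendsto_logIntegrand_contour hp (-(z + 1))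
  rw [cocompact_eq_atBot_atTop, tendsto_sup] at hlim
  have h := integral_of_hasDerivAt_of_tendsto hd (i0.sub i1) hlim.1 hlim.2
  rw [integral_sub i0 i1, integral_const_mul, sub_zero] at h
  exact sub_eq_zero.1 h

theorem contourIntegral_add_nat {p : ℝ} (hp : p ∈ Ioo (0 : ℝ) 1) {z : ℝ} (hz : z ∈ Ioc (-1 : ℝ) 0)
    (n : ℕ) : contourIntegral p (-(z + n)) 0 = 2 * Real.pi * I / Real.Gamma (z + n + 1) := by
  induction n with
  | zero =>
    rw [Nat.cast_zero, add_zero, add_comm z]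
    rcases eq_or_lt_of_le hz.2 with rfl | h
    · simpa using contourIntegral_zero hp
    · exact contourIntegral_of_neg hp ⟨hz.1, h⟩
  | succ n ih =>
    have hpos : 0 < z + n + 1 := by linarith [hz.1, (Nat.cast_nonneg n : (0 : ℝ) ≤ n)]
    have hr := contourIntegral_recurrence hp (z + n)
    have hG : (Real.Gamma (z + n + 1) : ℂ) ≠ 0 := by
      exact_mod_cast (Real.Gamma_pos_of_pos hpos).ne'
    have hne : ((z + n + 1 : ℝ) : ℂ) ≠ 0 := by exact_mod_cast hpos.ne'
    push_cast
    rw [← add_assoc, Real.Gamma_add_one hpos.ne', Complex.ofReal_mul]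
    rw [ih] at hr
    field_simp at hr ⊢
    rw [mul_assoc] at hr ⊢
    push_cast at hr ⊢
    linear_combination -hr

/-- Hankel's formula. -/
theorem contourIntegral_eq_div_Gamma {p : ℝ} (hp : p ∈ Ioo (0 : ℝ) 1) {s : ℝ} (hs : 0 ≤ s) :
    contourIntegral p (-s) 0 = 2 * Real.pi * I / Real.Gamma (s + 1) := by
  -- Subtracting the ceiling places the starting point in `(-1, 0]`, where both base cases are
  -- available.
  have h := contourIntegral_add_nat hp (z := s - ⌈s⌉₊)
    ⟨by linarith [Nat.ceil_lt_add_one hs], by linarith [Nat.le_ceil s]⟩ ⌈s⌉₊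
  rwa [sub_add_cancel] at h

/-! ### The density and its moments -/

/-- Conjugation reflects the contour onto itself with reversed orientation. The integral is thus
purely imaginary and the density real. -/
theorem conj_contourIntegral (p a x : ℝ) :
    (starRingEnd ℂ) (contourIntegral p a x) = -contourIntegral p a x := by
  have h1 : ∀ u : ℂ, (starRingEnd ℂ) (logIntegrand p a x u) =
      logIntegrand p a x ((starRingEnd ℂ) u) := by
    intro u
    simp only [logIntegrand, ← Complex.exp_conj, map_add, map_sub, map_mul, Complex.conj_ofReal]
  have h2 : ∀ y : ℝ, (starRingEnd ℂ) (contour p y) = contour p (-y) := by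
    intro y
    apply Complex.ext <;> simp
  have h3 : ∀ y : ℝ, (starRingEnd ℂ) (contourDeriv p y) = -contourDeriv p (-y) := by
    intro y
    simp only [contourDeriv, map_add, map_mul, Complex.conj_ofReal, Complex.conj_I, neg_sq]
    push_cast
    ring
  rw [contourIntegral, ← integral_conj, ← integral_neg]
  simp only [map_mul, h1, h2, h3, mul_neg]
  exact integral_neg_eq_self (fun y : ℝ => -(logIntegrand p a x (contour p y) * contourDeriv p y))
    volume

/-- The density of the limit distribution, extended continuously to the negative half line. -/
noncomputable def limitDensity (p x : ℝ) : ℝ :=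
  (1 / (2 * Real.pi * I) * contourIntegral p p (max x 0)).re

theorem ofReal_limitDensity (p : ℝ) {x : ℝ} (hx : 0 ≤ x) :
    (limitDensity p x : ℂ) = 1 / (2 * Real.pi * I) * contourIntegral p p x := by
  rw [limitDensity, max_eq_left hx]
  refine Complex.conj_eq_iff_re.1 ?_
  have h : (starRingEnd ℂ) (1 / (2 * Real.pi * I)) = -(1 / (2 * Real.pi * I)) := by
    rw [map_div₀, map_mul, map_mul, Complex.conj_I, Complex.conj_ofReal, map_one, Complex.conj_ofNat]
    ring
  rw [map_mul, conj_contourIntegral, h, neg_mul_neg]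

theorem continuous_contourIntegral_max {p : ℝ} (hp : p ∈ Ioo (0 : ℝ) 1) (a : ℝ) :
    Continuous fun x : ℝ => contourIntegral p a (max x 0) := by
  refine continuous_of_dominated
    (bound := fun y => ‖logIntegrand p a 0 (contour p y) * contourDeriv p y‖)
    (fun x => Continuous.aestronglyMeasurable (by fun_prop)) (fun x => ae_of_all _ fun y => ?_)
    (integrable_contour_zero hp a).norm (ae_of_all _ fun y => ?_)
  · refine (norm_contour_integrand_le hp (le_max_right x 0) y).trans ?_
    refine mul_le_of_le_one_left (norm_nonneg _) (Real.exp_le_one_iff.2 ?_)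
    exact neg_nonpos.2 (mul_nonneg (decayRate_pos hp 0).le (le_max_right x 0))
  · unfold logIntegrand
    fun_prop

theorem continuous_limitDensity {p : ℝ} (hp : p ∈ Ioo (0 : ℝ) 1) : Continuous (limitDensity p) :=
  Complex.continuous_re.comp (continuous_const.mul (continuous_contourIntegral_max hp p))

/-- The density decays faster than any exponential. -/
theorem exists_limitDensity_bound {p : ℝ} (hp : p ∈ Ioo (0 : ℝ) 1) {c : ℝ} (hc : 0 < c) :
    ∃ C, ∀ x, 0 ≤ x → |limitDensity p x| ≤ C * Real.exp (-(c * x)) := by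
  -- Shifting the contour by `l` multiplies the decay rate by `exp (p * l)`, so every positive rate
  -- can be reached.
  obtain ⟨l, hl⟩ : ∃ l, decayRate p l = c := by
    have h := cos_opening_pos hp
    refine ⟨Real.log (c / Real.cos (p * opening p * (Real.pi / 2))) / p, ?_⟩
    rw [decayRate, mul_div_cancel₀ _ hp.1.ne', Real.exp_log (by positivity), div_mul_cancel₀ _ h.ne']
  refine ⟨‖(1 / (2 * Real.pi * I) : ℂ)‖ *
    ∫ y, ‖logIntegrand p p 0 (contour p y + l) * contourDeriv p y‖, fun x hx => ?_⟩
  rw [limitDensity, max_eq_left hx]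
  refine (Complex.abs_re_le_norm _).trans ?_
  rw [norm_mul, mul_assoc ‖(1 / (2 * Real.pi * I) : ℂ)‖, ← integral_mul_const,
    contourIntegral_eq_shifted hp p hx l]
  gcongr
  refine norm_integral_le_of_norm_le ((integrable_shifted_contour_zero hp p l).norm.mul_const _)
    (ae_of_all _ fun y => ?_)
  exact hl ▸ (norm_shifted_contour_integrand_le hp hx l y).trans_eq (mul_comm _ _)

theorem integrableOn_pow_mul_exp_neg {c : ℝ} (hc : 0 < c) (r : ℕ) :
    IntegrableOn (fun x : ℝ => x ^ r * Real.exp (-(c * x))) (Ioi 0) := by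
  have h := integrableOn_rpow_mul_exp_neg_mul_rpow (s := r) (p := 1) (b := c)
    (by linarith [(Nat.cast_nonneg r : (0 : ℝ) ≤ r)]) one_pos hc
  simpa using h

theorem integrableOn_pow_mul_limitDensity {p : ℝ} (hp : p ∈ Ioo (0 : ℝ) 1) (r : ℕ) :
    IntegrableOn (fun x : ℝ => x ^ r * limitDensity p x) (Ioi 0) := by
  obtain ⟨C, hC⟩ := exists_limitDensity_bound hp one_pos
  have hc := continuous_limitDensity hp
  refine ((integrableOn_pow_mul_exp_neg one_pos r).const_mul C).mono'
    (Continuous.aestronglyMeasurable (by fun_prop)) ?_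
  filter_upwards [ae_restrict_mem measurableSet_Ioi] with x hx
  rw [mem_Ioi] at hx
  rw [norm_mul, Real.norm_of_nonneg (by positivity), Real.norm_eq_abs, mul_left_comm]
  exact mul_le_mul_of_nonneg_left (hC x hx.le) (by positivity)

theorem integral_pow_mul_cexp_neg {z : ℂ} (hz : 0 < z.re) (r : ℕ) :
    ∫ x : ℝ in Ioi 0, (x : ℂ) ^ r * Complex.exp (-(z * x)) = r.factorial / z ^ (r + 1) := by
  have hz0 : z ≠ 0 := fun h => by simp [h] at hz
  have hint : ∀ r : ℕ, IntegrableOn (fun x : ℝ => (x : ℂ) ^ r * Complex.exp (-(z * x))) (Ioi 0) := by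
    intro r
    refine (integrableOn_pow_mul_exp_neg hz r).mono' (Continuous.aestronglyMeasurable (by fun_prop)) ?_
    filter_upwards [ae_restrict_mem measurableSet_Ioi] with x hx
    rw [norm_mul, norm_pow, Complex.norm_real, Real.norm_of_nonneg (le_of_lt hx), Complex.norm_exp]
    simp
  have hexp : ∀ x : ℝ, HasDerivAt (fun x : ℝ => Complex.exp (-(z * x)))
      (Complex.exp (-(z * x)) * -z) x := by
    intro x
    simpa using ((Complex.ofRealCLM.hasDerivAt (x := x)).const_mul z).fun_neg.cexp
  induction r with
  | zero =>
    have hd : ∀ x : ℝ, HasDerivAt (fun x : ℝ => -z⁻¹ * Complex.exp (-(z * x)))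
        ((x : ℂ) ^ 0 * Complex.exp (-(z * x))) x := fun x =>
      ((hexp x).const_mul (-z⁻¹)).congr_deriv (by field_simp)
    have hlim := tendsto_zero_of_hasDerivAt_of_integrableOn_Ioi (a := 0) (fun x _ => hd x) (hint 0)
      (((hint 0).const_mul (-z⁻¹)).congr (ae_of_all _ fun x => by simp))
    have h := integral_Ioi_of_hasDerivAt_of_tendsto' (a := 0) (fun x _ => hd x) (hint 0) hlim
    rw [h]
    simp
  | succ r ih =>
    have hd : ∀ x : ℝ, HasDerivAt (fun x : ℝ => (x : ℂ) ^ (r + 1) * Complex.exp (-(z * x)))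
        ((r + 1) * ((x : ℂ) ^ r * Complex.exp (-(z * x))) -
          z * ((x : ℂ) ^ (r + 1) * Complex.exp (-(z * x)))) x := fun x =>
      (((Complex.ofRealCLM.hasDerivAt (x := x)).pow (r + 1)).mul (hexp x)).congr_deriv (by
        simp
        ring)
    have hi := ((hint r).const_mul ((r : ℂ) + 1)).sub ((hint (r + 1)).const_mul z)
    have hlim := tendsto_zero_of_hasDerivAt_of_integrableOn_Ioi (a := 0) (fun x _ => hd x) hi
      (hint (r + 1))
    have h := integral_Ioi_of_hasDerivAt_of_tendsto' (a := 0) (fun x _ => hd x) hi hlim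
    rw [integral_sub ((hint r).const_mul _) ((hint (r + 1)).const_mul z), integral_const_mul,
      integral_const_mul, ih] at h
    have h0 : ((0 : ℝ) : ℂ) ^ (r + 1) = 0 := by simp
    rw [h0, zero_mul, sub_zero, sub_eq_zero] at h
    rw [Nat.factorial_succ, eq_div_iff (pow_ne_zero _ hz0), pow_succ, mul_comm, mul_assoc, ← h]
    push_cast
    field_simp

/-- The integral over `x` produces `r! exp (-(r + 1) p u)`, which lowers the exponent from `p` to
`-(r * p)`. -/
theorem integral_pow_mul_logIntegrand {p : ℝ} (r : ℕ) {u : ℂ}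
    (hu : 0 < (Complex.exp (p * u)).re) :
    ∫ x : ℝ in Ioi 0, ((x ^ r : ℝ) : ℂ) * logIntegrand p p x u =
      r.factorial * logIntegrand p (-(r * p)) 0 u := by
  have heq : ∀ x : ℝ, ((x ^ r : ℝ) : ℂ) * logIntegrand p p x u =
      logIntegrand p p 0 u * ((x : ℂ) ^ r * Complex.exp (-(Complex.exp (p * u) * x))) := by
    intro x
    rw [logIntegrand_eq_mul, mul_comm (x : ℂ) (Complex.exp _)]
    push_cast
    ring
  simp_rw [heq]
  rw [integral_const_mul, integral_pow_mul_cexp_neg hu, ← Complex.exp_nat_mul, div_eq_mul_inv,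
    ← Complex.exp_neg, mul_left_comm]
  congr 1
  rw [logIntegrand, logIntegrand, ← Complex.exp_add]
  congr 1
  push_cast
  ring

theorem exp_mul_contour_re_pos {p : ℝ} (hp : p ∈ Ioo (0 : ℝ) 1) (y : ℝ) :
    0 < (Complex.exp (p * contour p y)).re := by
  rw [Complex.exp_re]
  refine mul_pos (Real.exp_pos _) (Real.cos_pos_of_mem_Ioo ?_)
  rw [Complex.im_ofReal_mul, contour_im, ← mul_assoc]
  have hb := mul_pos hp.1 (opening_pos hp)
  have hb1 := mul_opening_lt_one hp
  have h := abs_lt.1 (abs_arctan_lt y)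
  constructor <;> nlinarith [h.1, h.2, Real.pi_pos]

/-- Fubini reduces the moment to a contour integral at `x = 0`, which Hankel's formula evaluates.
The interchange is legitimate because on the contour the integrand decays exponentially in `x` at
the uniform rate `decayRate p 0`. -/
theorem integral_pow_mul_limitDensity {p : ℝ} (hp : p ∈ Ioo (0 : ℝ) 1) (r : ℕ) :
    ∫ x : ℝ in Ioi 0, x ^ r * limitDensity p x = r.factorial / Real.Gamma (r * p + 1) := by
  have hprod : Integrable (fun q : ℝ × ℝ => ((q.1 ^ r : ℝ) : ℂ) *
      (logIntegrand p p q.1 (contour p q.2) * contourDeriv p q.2))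
      ((volume.restrict (Ioi 0)).prod volume) := by
    have hb := (integrableOn_pow_mul_exp_neg (decayRate_pos hp 0) r).mul_prod
      (integrable_contour_zero hp p).norm
    refine hb.mono' (Continuous.aestronglyMeasurable ?_) ?_
    · unfold logIntegrand
      fun_prop
    · have hpos : ∀ᵐ q : ℝ × ℝ ∂((volume.restrict (Ioi 0)).prod volume), 0 < q.1 :=
        Measure.quasiMeasurePreserving_fst.ae (ae_restrict_mem measurableSet_Ioi)
      filter_upwards [hpos] with q hq
      rw [norm_mul, Complex.norm_real, Real.norm_of_nonneg (by positivity), mul_assoc]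
      exact mul_le_mul_of_nonneg_left (norm_contour_integrand_le hp hq.le q.2) (by positivity)
  have hswap := integral_integral_swap (f := fun x y => ((x ^ r : ℝ) : ℂ) *
      (logIntegrand p p x (contour p y) * contourDeriv p y)) hprod
  have hright : ∀ y : ℝ, ∫ x : ℝ in Ioi 0, ((x ^ r : ℝ) : ℂ) *
      (logIntegrand p p x (contour p y) * contourDeriv p y) =
      r.factorial * (logIntegrand p (-(r * p)) 0 (contour p y) * contourDeriv p y) := by
    intro y
    simp_rw [← mul_assoc]
    rw [integral_mul_const, integral_pow_mul_logIntegrand r (exp_mul_contour_re_pos hp y)]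
  simp_rw [hright, integral_const_mul] at hswap
  have hleft : ∫ x : ℝ in Ioi 0, ((x ^ r * limitDensity p x : ℝ) : ℂ) =
      1 / (2 * Real.pi * I) * ∫ x : ℝ in Ioi 0, ((x ^ r : ℝ) : ℂ) *
        ∫ y, logIntegrand p p x (contour p y) * contourDeriv p y := by
    rw [← integral_const_mul]
    refine setIntegral_congr_fun measurableSet_Ioi fun x hx => ?_
    rw [Complex.ofReal_mul, ofReal_limitDensity p (le_of_lt hx), contourIntegral]
    ring
  have hJ := contourIntegral_eq_div_Gamma hp (s := r * p) (mul_nonneg (Nat.cast_nonneg r) hp.1.le)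
  rw [contourIntegral] at hJ
  rw [hswap, hJ, integral_complex_ofReal] at hleft
  have hπ : (Real.pi : ℂ) ≠ 0 := by exact_mod_cast Real.pi_ne_zero
  apply Complex.ofReal_injective
  rw [hleft]
  push_cast
  have hI := Complex.I_ne_zero
  field_simp

end BernoulliGrowth

namespace BernoulliGrowth

open scoped Topology ENNReal

/-! ### Rapidly decaying densities -/

/-- Continuous functions that decay on the positive half line faster than any exponential. -/
def RapidlyDecreasing (g : ℝ → ℝ) : Prop :=
  Continuous g ∧ ∀ c : ℝ, 0 < c → ∃ C, ∀ x, 0 ≤ x → |g x| ≤ C * Real.exp (-(c * x))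

theorem RapidlyDecreasing.neg {g : ℝ → ℝ} (hg : RapidlyDecreasing g) :
    RapidlyDecreasing (fun x => -g x) :=
  ⟨hg.1.neg, fun c hc => by simpa using hg.2 c hc⟩

theorem rapidlyDecreasing_limitDensity {p : ℝ} (hp : p ∈ Ioo (0 : ℝ) 1) :
    RapidlyDecreasing (limitDensity p) :=
  ⟨continuous_limitDensity hp, fun _ hc => exists_limitDensity_bound hp hc⟩

/-- The measure on `(0, ∞)` with the positive part of `g` as its density. -/
noncomputable def densityMeasure (g : ℝ → ℝ) : Measure ℝ :=
  (volume.restrict (Ioi 0)).withDensity fun x => ENNReal.ofReal (g x)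

theorem integral_pow_mul_exp_neg {c : ℝ} (hc : 0 < c) (r : ℕ) :
    ∫ x : ℝ in Ioi 0, x ^ r * Real.exp (-(c * x)) = r.factorial / c ^ (r + 1) := by
  have h := integral_pow_mul_cexp_neg (z := c) (by simpa using hc) r
  apply Complex.ofReal_injective
  rw [← integral_complex_ofReal]
  push_cast
  exact h

theorem abs_pow_mul_posPart_le {g : ℝ → ℝ} {c C : ℝ}
    (hC : ∀ x, 0 ≤ x → |g x| ≤ C * Real.exp (-(c * x))) (r : ℕ) {x : ℝ} (hx : 0 ≤ x) :
    |max (g x) 0 * x ^ r| ≤ C * (x ^ r * Real.exp (-(c * x))) := by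
  rw [abs_of_nonneg (by positivity), mul_comm, mul_left_comm]
  refine mul_le_mul_of_nonneg_left (le_trans ?_ (hC x hx)) (by positivity)
  exact max_le (le_abs_self _) (abs_nonneg _)

namespace RapidlyDecreasing

variable {g : ℝ → ℝ}

theorem integrableOn_posPart (hg : RapidlyDecreasing g) (r : ℕ) :
    IntegrableOn (fun x => max (g x) 0 * x ^ r) (Ioi 0) := by
  obtain ⟨C, hC⟩ := hg.2 1 one_pos
  have := hg.1
  refine ((integrableOn_pow_mul_exp_neg one_pos r).const_mul C).mono'
    (Continuous.aestronglyMeasurable (by fun_prop)) ?_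
  filter_upwards [ae_restrict_mem measurableSet_Ioi] with x hx
  exact abs_pow_mul_posPart_le hC r (le_of_lt hx)

theorem integrable_pow (hg : RapidlyDecreasing g) (r : ℕ) :
    Integrable (fun x : ℝ => x ^ r) (densityMeasure g) := by
  rw [densityMeasure, integrable_withDensity_iff_integrable_smul'
    hg.1.measurable.ennreal_ofReal (ae_of_all _ fun x => ENNReal.ofReal_lt_top)]
  simpa [ENNReal.toReal_ofReal', IntegrableOn] using hg.integrableOn_posPart r

theorem integral_pow (hg : RapidlyDecreasing g) (r : ℕ) :
    ∫ x, x ^ r ∂(densityMeasure g) = ∫ x in Ioi 0, max (g x) 0 * x ^ r := by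
  rw [densityMeasure, integral_withDensity_eq_integral_toReal_smul
    hg.1.measurable.ennreal_ofReal (ae_of_all _ fun x => ENNReal.ofReal_lt_top)]
  simp [ENNReal.toReal_ofReal']

theorem integrable_exp (hg : RapidlyDecreasing g) (t : ℝ) :
    Integrable (fun x : ℝ => Real.exp (t * x)) (densityMeasure g) := by
  rw [densityMeasure, integrable_withDensity_iff_integrable_smul'
    hg.1.measurable.ennreal_ofReal (ae_of_all _ fun x => ENNReal.ofReal_lt_top)]
  -- The surplus `1` in the rate leaves the integrable bound `exp (-x)` after multiplication by `exp
  -- (t * x)`.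
  obtain ⟨C, hC⟩ := hg.2 (|t| + 1) (by positivity)
  have := hg.1
  simp only [ENNReal.toReal_ofReal', smul_eq_mul]
  refine ((integrableOn_pow_mul_exp_neg one_pos 0).const_mul C).mono'
    (Continuous.aestronglyMeasurable (by fun_prop)) ?_
  filter_upwards [ae_restrict_mem measurableSet_Ioi] with x hx
  rw [mem_Ioi] at hx
  have h := abs_pow_mul_posPart_le hC 0 hx.le
  simp only [pow_zero, mul_one, one_mul] at h ⊢
  rw [norm_mul, Real.norm_eq_abs, Real.norm_of_nonneg (Real.exp_pos _).le]
  have hC0 : 0 ≤ C := nonneg_of_mul_nonneg_left ((abs_nonneg _).trans h) (Real.exp_pos _)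
  calc |max (g x) 0| * Real.exp (t * x)
      ≤ C * Real.exp (-((|t| + 1) * x)) * Real.exp (t * x) := by gcongr
    _ = C * Real.exp (-((|t| + 1) * x) + t * x) := by rw [mul_assoc, ← Real.exp_add]
    _ ≤ C * Real.exp (-x) := by
      gcongr
      nlinarith [le_abs_self t]

theorem isFiniteMeasure (hg : RapidlyDecreasing g) : IsFiniteMeasure (densityMeasure g) := by
  have h := hg.integrable_pow 0
  simp only [pow_zero] at h
  exact (integrable_const_iff_isFiniteMeasure one_ne_zero).1 h

/-- Decay at rate `|t| + 1` bounds the `r`-th moment by `C r! / (|t| + 1) ^ (r + 1)`, and the series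
is dominated by a geometric one. -/
theorem summable_moments (hg : RapidlyDecreasing g) (t : ℝ) :
    Summable fun r : ℕ => |t| ^ r / r.factorial * ∫ x, x ^ r ∂(densityMeasure g) := by
  have hc : 0 < |t| + 1 := by positivity
  obtain ⟨C, hC⟩ := hg.2 (|t| + 1) hc
  have hgeo : Summable fun r : ℕ => C / (|t| + 1) * (|t| / (|t| + 1)) ^ r :=
    (summable_geometric_of_lt_one (by positivity) ((div_lt_one hc).2 (by linarith))).mul_left _
  refine Summable.of_nonneg_of_le (fun r => ?_) (fun r => ?_) hgeo
  · rw [hg.integral_pow]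
    have : 0 ≤ ∫ x in Ioi 0, max (g x) 0 * x ^ r :=
      setIntegral_nonneg measurableSet_Ioi fun x hx => by
        have := le_of_lt (mem_Ioi.1 hx)
        positivity
    positivity
  · have hle : ∫ x, x ^ r ∂(densityMeasure g) ≤ C * (r.factorial / (|t| + 1) ^ (r + 1)) := by
      rw [hg.integral_pow, ← integral_pow_mul_exp_neg hc, ← integral_const_mul]
      refine setIntegral_mono_on (hg.integrableOn_posPart r)
        ((integrableOn_pow_mul_exp_neg hc r).const_mul C) measurableSet_Ioi fun x hx => ?_
      exact (le_abs_self _).trans (abs_pow_mul_posPart_le hC r (le_of_lt hx))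
    refine (mul_le_mul_of_nonneg_left hle (by positivity)).trans_eq ?_
    have : (r.factorial : ℝ) ≠ 0 := by positivity
    rw [div_pow, pow_succ]
    field_simp

theorem tendsto_moments_zero (hg : RapidlyDecreasing g) (t : ℝ) :
    Tendsto (fun k : ℕ => t ^ (2 * k) / (2 * k).factorial * ∫ x, x ^ (2 * k) ∂(densityMeasure g))
      atTop (𝓝 0) := by
  have h := (hg.summable_moments t).tendsto_atTop_zero.comp
    (tendsto_id.const_mul_atTop' (show 0 < 2 by norm_num))
  refine h.congr fun k => ?_
  simp only [Function.comp_apply, id_eq, (even_two_mul k).pow_abs]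

end RapidlyDecreasing

/-! ### The laws of the normalized degrees -/

/-- The law of the normalized degree of a pole in the network of size `n + 1`. -/
noncomputable def normalizedDegreeLaw (p : ℝ) (hp : p ∈ Icc (0 : ℝ) 1) (n : ℕ) : Measure ℝ :=
  (degreeLaw p hp n).toMeasure.map fun d : ℕ => (d : ℝ) / ((n + 1 : ℕ) : ℝ) ^ p

instance (p : ℝ) (hp : p ∈ Icc (0 : ℝ) 1) (n : ℕ) :
    IsProbabilityMeasure (normalizedDegreeLaw p hp n) :=
  Measure.isProbabilityMeasure_map (by fun_prop)

theorem integrable_pow_normalizedDegreeLaw {p : ℝ} (hp : p ∈ Icc (0 : ℝ) 1) (n r : ℕ) :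
    Integrable (fun x : ℝ => x ^ r) (normalizedDegreeLaw p hp n) := by
  rw [normalizedDegreeLaw, integrable_map_measure (by fun_prop) (by fun_prop)]
  simp only [Function.comp_def, div_pow]
  exact (integrable_pow_degreeLaw hp r n).div_const _

theorem tendsto_moments_normalizedDegreeLaw {p : ℝ} (hp : p ∈ Ioo (0 : ℝ) 1) (r : ℕ) :
    Tendsto (fun n => ∫ x, x ^ r ∂(normalizedDegreeLaw p (Ioo_subset_Icc_self hp) n)) atTop
      (𝓝 (r.factorial / Real.Gamma (r * p + 1))) := by
  refine (tendsto_integral_pow_degreeLaw hp r).congr fun n => ?_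
  rw [normalizedDegreeLaw, integral_map (by fun_prop) (by fun_prop)]

/-! ### Positivity of the density -/

/-- The moments of the signed density, rewritten with both parts as genuine measures, so that they
can be used before the sign of the density is known. -/
theorem moments_posPart_limitDensity {p : ℝ} (hp : p ∈ Ioo (0 : ℝ) 1) (r : ℕ) :
    ∫ x, x ^ r ∂(densityMeasure (limitDensity p)) = r.factorial / Real.Gamma (r * p + 1) +
      ∫ x, x ^ r ∂(densityMeasure fun x => -limitDensity p x) := by
  have hf := rapidlyDecreasing_limitDensity hp
  rw [← integral_pow_mul_limitDensity hp, hf.integral_pow, hf.neg.integral_pow,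
    ← integral_add (integrableOn_pow_mul_limitDensity hp r) (hf.neg.integrableOn_posPart r)]
  refine setIntegral_congr_fun measurableSet_Ioi fun x _ => ?_
  rcases le_total (limitDensity p x) 0 with h | h
  · rw [max_eq_right h, max_eq_left (neg_nonneg.2 h)]
    ring
  · rw [max_eq_left h, max_eq_right (neg_nonpos.2 h)]
    ring

/-- If the density took negative values, then mixing the laws of the normalized degrees with its
negative part would give measures that converge to its positive part, where the negative part has no
mass. -/
theorem limitDensity_nonneg {p : ℝ} (hp : p ∈ Ioo (0 : ℝ) 1) {x₀ : ℝ} (hx₀ : 0 < x₀) :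
    0 ≤ limitDensity p x₀ := by
  by_contra! hneg
  have hf := rapidlyDecreasing_limitDensity hp
  set pos := densityMeasure (limitDensity p) with hpos
  set neg := densityMeasure fun x => -limitDensity p x with hnegdef
  have : IsFiniteMeasure pos := hf.isFiniteMeasure
  have : IsFiniteMeasure neg := hf.neg.isFiniteMeasure
  have hmass : pos.real univ = 1 + neg.real univ := by
    simpa using moments_posPart_limitDensity hp 0
  -- `M` is the common total mass of `L n + neg` and `pos`; scaling by `c = M⁻¹` gives probability
  -- measures.
  set M := 1 + neg.real univ with hM
  have hM0 : 0 < M := by positivity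
  let c : ℝ≥0∞ := ENNReal.ofReal M⁻¹
  have hcM : c * ENNReal.ofReal M = 1 := by
    rw [← ENNReal.ofReal_mul (by positivity), inv_mul_cancel₀ hM0.ne', ENNReal.ofReal_one]
  have hcr : c.toReal = M⁻¹ := ENNReal.toReal_ofReal (by positivity)
  let L : ℕ → Measure ℝ := normalizedDegreeLaw p (Ioo_subset_Icc_self hp)
  let P : ℕ → Measure ℝ := fun n => c • (L n + neg)
  have hPprob : ∀ n, IsProbabilityMeasure (P n) := fun n => ⟨by
    have : (1 : ℝ≥0∞) + neg univ = ENNReal.ofReal M := by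
      rw [hM, ENNReal.ofReal_add zero_le_one measureReal_nonneg, ENNReal.ofReal_one,
        ofReal_measureReal]
    simp only [P, L, Measure.smul_apply, Measure.add_apply, measure_univ, smul_eq_mul, this, hcM]⟩
  have hQprob : IsProbabilityMeasure (c • pos) := ⟨by
    rw [Measure.smul_apply, smul_eq_mul, ← ofReal_measureReal (μ := pos), hmass, hcM]⟩
  have hLi : ∀ n r, Integrable (fun x : ℝ => x ^ r) (L n) := fun n r =>
    integrable_pow_normalizedDegreeLaw _ n r
  have hPi : ∀ n (r : ℕ), Integrable (fun x : ℝ => x ^ r) (P n) := fun n r =>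
    ((hLi n r).add_measure (hf.neg.integrable_pow r)).smul_measure ENNReal.ofReal_ne_top
  have hQi : ∀ r : ℕ, Integrable (fun x : ℝ => x ^ r) (c • pos) := fun r =>
    (hf.integrable_pow r).smul_measure ENNReal.ofReal_ne_top
  have hmom : ∀ r : ℕ, Tendsto (fun n => ∫ x, x ^ r ∂(P n)) atTop
      (𝓝 (∫ x, x ^ r ∂(c • pos))) := by
    intro r
    simp only [P, integral_smul_measure, hcr, smul_eq_mul]
    refine Tendsto.const_mul _ ?_
    rw [hpos, moments_posPart_limitDensity hp r]
    refine ((tendsto_moments_normalizedDegreeLaw hp r).add_const _).congr fun n => ?_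
    exact (integral_add_measure (hLi n r) (hf.neg.integrable_pow r)).symm
  have hsmall : ∀ t : ℝ, Tendsto (fun k : ℕ => t ^ (2 * k) / (2 * k).factorial *
      ∫ x, x ^ (2 * k) ∂(c • pos)) atTop (𝓝 0) := by
    intro t
    have h := (hf.tendsto_moments_zero t).const_mul M⁻¹
    rw [mul_zero] at h
    refine h.congr fun k => ?_
    rw [integral_smul_measure, hcr, smul_eq_mul]
    ring
  let P' : ℕ → ProbabilityMeasure ℝ := fun n => ⟨P n, hPprob n⟩
  let Q' : ProbabilityMeasure ℝ := ⟨c • pos, hQprob⟩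
  have hconv : Tendsto P' atTop (𝓝 Q') :=
    ProbabilityMeasure.tendsto_iff_tendsto_charFun.2 fun t =>
      tendsto_charFun_of_tendsto_moments (μs := P) hPi hQi hmom t (hsmall t)
  -- Continuity gives a closed ball inside `(0, ∞)` on which the density is negative: `pos` does not
  -- charge it, `neg` does.
  have hnhds : {x | limitDensity p x < 0} ∩ Ioi 0 ∈ 𝓝 x₀ :=
    inter_mem ((isOpen_lt hf.1 continuous_const).mem_nhds hneg) (Ioi_mem_nhds hx₀)
  obtain ⟨ε, hε, hball⟩ := Metric.nhds_basis_closedBall.mem_iff.1 hnhds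
  have hF : MeasurableSet (Metric.closedBall x₀ ε) := measurableSet_closedBall
  have hport := ProbabilityMeasure.limsup_measure_closed_le_of_tendsto hconv
    (F := Metric.closedBall x₀ ε) Metric.isClosed_closedBall
  have hQ0 : (Q' : Measure ℝ) (Metric.closedBall x₀ ε) = 0 := by
    show (c • pos) (Metric.closedBall x₀ ε) = 0
    rw [Measure.smul_apply, hpos, densityMeasure, withDensity_apply _ hF,
      setLIntegral_congr_fun hF (g := 0) fun x hx =>
        ENNReal.ofReal_of_nonpos (hball hx).1.le]
    simp
  have hneg0 : neg (Metric.closedBall x₀ ε) ≠ 0 := by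
    intro h0
    rw [hnegdef, densityMeasure, withDensity_apply_eq_zero
      hf.neg.1.measurable.ennreal_ofReal, Measure.restrict_apply'
      measurableSet_Ioi] at h0
    refine (Metric.measure_closedBall_pos volume x₀ hε).ne' (measure_mono_null ?_ h0)
    intro x hx
    refine ⟨⟨?_, hx⟩, (hball hx).2⟩
    simpa using (hball hx).1
  have hle : c * neg (Metric.closedBall x₀ ε) ≤
      limsup (fun n => (P' n : Measure ℝ) (Metric.closedBall x₀ ε)) atTop := by
    refine le_limsup_of_frequently_le (Frequently.of_forall fun n => ?_)
    show _ ≤ (c • (L n + neg)) (Metric.closedBall x₀ ε)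
    rw [Measure.smul_apply, Measure.add_apply, smul_eq_mul]
    gcongr
    exact le_add_self
  rw [hQ0] at hport
  have hc0 : c ≠ 0 := fun h => by simp [h] at hcM
  exact mul_ne_zero hc0 hneg0 (le_antisymm (hle.trans hport) zero_le)

/-! ### The limit distribution -/

theorem integral_pow_densityMeasure_limitDensity {p : ℝ} (hp : p ∈ Ioo (0 : ℝ) 1) (r : ℕ) :
    ∫ x, x ^ r ∂(densityMeasure (limitDensity p)) = r.factorial / Real.Gamma (r * p + 1) := by
  rw [(rapidlyDecreasing_limitDensity hp).integral_pow, ← integral_pow_mul_limitDensity hp]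
  refine setIntegral_congr_fun measurableSet_Ioi fun x hx => ?_
  rw [max_eq_left (limitDensity_nonneg hp hx), mul_comm]

theorem isProbabilityMeasure_limit {p : ℝ} (hp : p ∈ Ioo (0 : ℝ) 1) :
    IsProbabilityMeasure (densityMeasure (limitDensity p)) := by
  have := (rapidlyDecreasing_limitDensity hp).isFiniteMeasure
  have h := integral_pow_densityMeasure_limitDensity hp 0
  refine ⟨?_⟩
  rw [← ofReal_measureReal]
  simp only [pow_zero, integral_const, smul_eq_mul, mul_one] at h
  simp [h]

theorem ae_pos_densityMeasure (g : ℝ → ℝ) : ∀ᵐ x ∂(densityMeasure g), 0 < x :=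
  (withDensity_absolutelyContinuous _ _).ae_le (ae_restrict_mem measurableSet_Ioi)

/-- The exponential series is integrated term by term. The measure lives on `(0, ∞)`, so the
integrals of the absolute values are themselves moments, and `summable_moments` applies. -/
theorem isMittagLeffler_limit {p : ℝ} (hp : p ∈ Ioo (0 : ℝ) 1) :
    IsMittagLeffler p (densityMeasure (limitDensity p)) := by
  intro t
  have hf := rapidlyDecreasing_limitDensity hp
  have hint : ∀ r : ℕ, Integrable (fun x : ℝ => t ^ r / r.factorial * x ^ r)
      (densityMeasure (limitDensity p)) := fun r => (hf.integrable_pow r).const_mul _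
  have hnorm : ∀ r : ℕ, ∫ x, ‖t ^ r / r.factorial * x ^ r‖ ∂(densityMeasure (limitDensity p)) =
      |t| ^ r / r.factorial * ∫ x, x ^ r ∂(densityMeasure (limitDensity p)) := by
    intro r
    rw [← integral_const_mul]
    refine integral_congr_ae ?_
    filter_upwards [ae_pos_densityMeasure (limitDensity p)] with x hx
    rw [norm_mul, norm_div, norm_pow, Real.norm_eq_abs, Real.norm_of_nonneg (by positivity),
      Real.norm_of_nonneg (by positivity)]
  have hsum : Summable fun r : ℕ =>
      ∫ x, ‖t ^ r / r.factorial * x ^ r‖ ∂(densityMeasure (limitDensity p)) := by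
    simpa only [hnorm] using hf.summable_moments t
  have hexp : ∀ x : ℝ, ∑' r : ℕ, t ^ r / r.factorial * x ^ r = Real.exp (t * x) := by
    intro x
    rw [Real.exp_eq_exp_ℝ, NormedSpace.exp_eq_tsum_div]
    exact tsum_congr fun r => by rw [mul_pow]; ring
  have h := hasSum_integral_of_summable_integral_norm hint hsum
  simp only [hexp, integral_const_mul, integral_pow_densityMeasure_limitDensity hp] at h
  refine ⟨hf.integrable_exp t, ?_⟩
  refine h.congr_fun fun r => ?_
  have : (r.factorial : ℝ) ≠ 0 := by positivity
  field_simp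

theorem eq_limit_of_moments {p : ℝ} (hp : p ∈ Ioo (0 : ℝ) 1) {μ : Measure ℝ}
    [IsProbabilityMeasure μ] (hμ : ∀ r : ℕ, Integrable (fun x : ℝ => x ^ r) μ ∧
      ∫ x, x ^ r ∂μ = (r.factorial : ℝ) / Real.Gamma (r * p + 1)) :
    μ = densityMeasure (limitDensity p) := by
  have hf := rapidlyDecreasing_limitDensity hp
  have := isProbabilityMeasure_limit hp
  exact eq_of_moments_eq (fun r => (hμ r).1) hf.integrable_pow
    (fun r => (hμ r).2.trans (integral_pow_densityMeasure_limitDensity hp r).symm)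
    hf.tendsto_moments_zero

theorem tendstoInDistribution_degree {p : ℝ} (hp : p ∈ Ioo (0 : ℝ) 1) {v : ℕ}
    (hv : v ∈ ({source, sink} : Set ℕ)) {ν : ProbabilityMeasure ℝ}
    (hν : (ν : Measure ℝ) = densityMeasure (limitDensity p)) :
    TendstoInDistribution
      (fun (n : ℕ) (G : Network (n + 1)) => (degree G v : ℝ) / ((n + 1 : ℕ) : ℝ) ^ p)
      atTop (id : ℝ → ℝ) (fun n => (networkLaw p (Ioo_subset_Icc_self hp) n).toMeasure)
      (ν : Measure ℝ) := by
  have hf := rapidlyDecreasing_limitDensity hp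
  have hmap : ∀ n, (networkLaw p (Ioo_subset_Icc_self hp) n).toMeasure.map
      (fun G : Network (n + 1) => (degree G v : ℝ) / ((n + 1 : ℕ) : ℝ) ^ p) =
      normalizedDegreeLaw p (Ioo_subset_Icc_self hp) n := by
    intro n
    rw [normalizedDegreeLaw, ← map_degree_networkLaw _ n hv,
      ← PMF.toMeasure_map _ _ (measurable_of_countable _),
      Measure.map_map (by fun_prop) (measurable_of_countable _)]
    rfl
  refine ⟨fun n => (measurable_of_countable _).aemeasurable, aemeasurable_id, ?_⟩
  refine ProbabilityMeasure.tendsto_iff_tendsto_charFun.2 fun t => ?_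
  simp only [ProbabilityMeasure.coe_mk, hmap, Measure.map_id]
  refine tendsto_charFun_of_tendsto_moments (fun n r => integrable_pow_normalizedDegreeLaw _ n r)
    (fun r => hν ▸ hf.integrable_pow r) (fun r => ?_) t (hν ▸ hf.tendsto_moments_zero t)
  rw [hν, integral_pow_densityMeasure_limitDensity hp]
  exact tendsto_moments_normalizedDegreeLaw hp r

end BernoulliGrowth

theorem mainTheorem1 (p : ℝ) (hp : p ∈ Set.Ioo (0 : ℝ) 1) :
    -- the degrees of the source and of the sink have the same law
    (∀ n : ℕ,
      (BernoulliGrowth.networkLaw p (Set.Ioo_subset_Icc_self hp) n).map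
          (fun G => BernoulliGrowth.degree G BernoulliGrowth.source) =
        (BernoulliGrowth.networkLaw p (Set.Ioo_subset_Icc_self hp) n).map
          (fun G => BernoulliGrowth.degree G BernoulliGrowth.sink)) ∧
    -- the law `ν` of the limit
    ∃ ν : ProbabilityMeasure ℝ,
      -- convergence in distribution, for both poles (the `n`-th network has size `n + 1`)
      (∀ v ∈ ({BernoulliGrowth.source, BernoulliGrowth.sink} : Set ℕ),
        TendstoInDistribution
          (fun (n : ℕ) (G : BernoulliGrowth.Network (n + 1)) =>
            (BernoulliGrowth.degree G v : ℝ) / ((n + 1 : ℕ) : ℝ) ^ p)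
          atTop (id : ℝ → ℝ)
          (fun n => (BernoulliGrowth.networkLaw p (Set.Ioo_subset_Icc_self hp) n).toMeasure)
          (ν : Measure ℝ)) ∧
      -- the limit is Mittag-Leffler with parameter `p`
      BernoulliGrowth.IsMittagLeffler p (ν : Measure ℝ) ∧
      -- its moments
      (∀ r : ℕ, Integrable (fun x : ℝ => x ^ r) (ν : Measure ℝ) ∧
        ∫ x, x ^ r ∂(ν : Measure ℝ) = (r.factorial : ℝ) / Real.Gamma (r * p + 1)) ∧
      -- the moments characterize it
      (∀ μ : ProbabilityMeasure ℝ,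
        (∀ r : ℕ, Integrable (fun x : ℝ => x ^ r) (μ : Measure ℝ) ∧
          ∫ x, x ^ r ∂(μ : Measure ℝ) = (r.factorial : ℝ) / Real.Gamma (r * p + 1)) →
        μ = ν) ∧
      -- its density
      ∃ f : ℝ → ℝ, Measurable f ∧ (∀ x, 0 < x → 0 ≤ f x) ∧
        (∀ δ x : ℝ, 0 < δ → 0 < x →
          BernoulliGrowth.HankelIntegrable δ (BernoulliGrowth.densityIntegrand p x) ∧
          (f x : ℂ) = 1 / (2 * Real.pi * Complex.I) *
            BernoulliGrowth.hankelIntegral δ (BernoulliGrowth.densityIntegrand p x)) ∧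
        (ν : Measure ℝ) =
          (volume.restrict (Set.Ioi 0)).withDensity (fun x => ENNReal.ofReal (f x)) := by
  have hf := BernoulliGrowth.rapidlyDecreasing_limitDensity hp
  refine ⟨fun n => ?_, ⟨BernoulliGrowth.densityMeasure (BernoulliGrowth.limitDensity p),
    BernoulliGrowth.isProbabilityMeasure_limit hp⟩, fun v hv => ?_,
    BernoulliGrowth.isMittagLeffler_limit hp, fun r => ⟨hf.integrable_pow r,
      BernoulliGrowth.integral_pow_densityMeasure_limitDensity hp r⟩, fun μ hμ => ?_,
    BernoulliGrowth.limitDensity p, hf.1.measurable,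
    fun x hx => BernoulliGrowth.limitDensity_nonneg hp hx, fun δ x hδ hx => ?_, rfl⟩
  · rw [BernoulliGrowth.map_degree_networkLaw _ n (by simp),
      BernoulliGrowth.map_degree_networkLaw _ n (by simp)]
  · exact BernoulliGrowth.tendstoInDistribution_degree hp hv rfl
  · exact Subtype.ext (BernoulliGrowth.eq_limit_of_moments (μ := (μ : Measure ℝ)) hp hμ)
  · obtain ⟨h1, h2⟩ := BernoulliGrowth.hankelIntegrable_and_hankelIntegral_eq hp hx.le hδ
    exact ⟨h1, by rw [h2, BernoulliGrowth.ofReal_limitDensity p hx.le]⟩
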